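/- Fix a relational schema $\Sigma$ (finitely many relation symbols, each of positive arity) and a Boolean UCQ$^{\neg}$ $q$ over $\Sigma$: a finite union of queries $\exists \bar x\,(\alpha_1\wedge\dots\wedge\alpha_n)$ where each $\alpha_i$ is a relational atom, a negated relational atom, or an inequality $t\neq t'$ (terms being constants or variables), and each variable that occurs in a negated atom or an inequality also occurs in a positive atom of the same disjunct. A database $D$ is a finite set of facts (atoms all of whose arguments are constants), and $\mathrm{const}(D)$ is the set of constants occurring in it. Let $D^-$ be the set of facts $R(\bar c)\notin D$ with $R\in\Sigma$ and all entries of $\bar c$ in $\mathrm{const}(D)$. Let $q^{\pm}$ be the query over the signed schema $\{+R,-R : R\in\Sigma\}$ obtained from $q$ by replacing each positive atom $R(\bar t)$ by $+R(\bar t)$ and each negated atom $\neg R(\bar t)$ by $-R(\bar t)$. A set $S\subseteq D$ is a positive support of $q$ in $D$ if $\{+\alpha : \alpha\in S\}\cup\{-\alpha : \alpha\in D^-\}\models q^{\pm}$; a fact is positive-relevant for $q$ in $D$ if it belongs to some inclusion-minimal positive support of $q$ in $D$. Proposition. For every fixed UCQ$^{\neg}$ $q$, it can be decided in $\mathrm{AC}^0$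 data complexity whether a fact $\alpha\in D$ is positive-relevant for $q$ in $D$, and this can be done through a first-order formula evaluated on $D$. That is: (1) for every relation symbol $R\in\Sigma$, of arity $k$, there is a first-order formula $\varphi_R(y_1,\dots,y_k)$ over $\Sigma$, equality and the constants of $q$, depending only on $q$, such that for every database $D$ and every fact $\alpha=R(c_1,\dots,c_k)\in D$, the sentence $\varphi_R(c_1,\dots,c_k)$, evaluated on $D$ with domain $\mathrm{const}(D)\cup\mathrm{const}(q)$, holds if and only if $\alpha$ is positive-relevant for $q$ in $D$; (2) the problem is in uniform $\mathrm{AC}^0$: take binary words as constants, and represent a pair $(D,\alpha)$ by a word that consists of $\alpha$ followed by a list of the facts of $D$ (in any order, possibly with repetitions), where a fact $R(c_1,\dots,c_k)$ is written as the letter $R$ followed by the words $c_1,\dots,c_k$, each terminated by an end marker. Then the set of all words that represent some $(D,\alpha)$ with $\alpha\in D$ positive-relevant for $q$ in $D$ is decided by a family $(C_n)_{n\ge 0}$ of circuits, $C_n$ reading words of length $n$, with NOT gates, AND and OR gates of unbounded fan-in and input gates testing whether a given position carries a given letter, of size polynomial in $n$ and depth bounded by a constant, which is first-order uniform: the gates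 of $C_n$ can be named by a tag from a finite set and a tuple of fixed length over $\{0,\dots,n\}$ so that the set of gates, their kinds, the wires and the output gate are defined by first-order formulas, independent of $n$, over $\{0,\dots,n\}$ with $\le$, $+$ and $\times$. -/

import Mathlib

/-! ## Databases and queries -/

/-- Constants: the words over a binary alphabet (a countably infinite set of names). -/
abbrev Const : Type := List Bool

/-- Variables. -/
abbrev Var : Type := ℕ

/-- A relational schema: a finite set of relation symbols, each with a positive arity. -/
structure Schema where
  Rel : Type
  finite_rel : Finite Rel
  arity : Rel → ℕ
  arity_pos : ∀ R, 0 < arity R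

/-- Terms are constants or variables. -/
inductive QTerm : Type
  | const (c : Const) : QTerm
  | var (x : Var) : QTerm

/-- The value of a term under a valuation of the variables. -/
def QTerm.eval (ν : Var → Const) : QTerm → Const
  | .const c => c
  | .var x => ν x

/-- Relational atoms `R(t₁, …, tₖ)`. -/
structure Atom (σ : Schema) where
  rel : σ.Rel
  args : Fin (σ.arity rel) → QTerm

/-- Facts: atoms containing only constants. -/
@[ext]
structure DBFact (σ : Schema) where
  rel : σ.Rel
  args : Fin (σ.arity rel) → Const

/-- The fact obtained from an atom by a valuation. -/
def Atom.eval {σ : Schema} (ν : Var → Const) (a : Atom σ) : DBFact σ :=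
  ⟨a.rel, fun i => (a.args i).eval ν⟩

/-- A variable occurs in an atom. -/
def Atom.HasVar {σ : Schema} (a : Atom σ) (x : Var) : Prop := ∃ i, a.args i = .var x

/-- A database is a finite set of facts. -/
abbrev Database (σ : Schema) : Type := Finset (DBFact σ)

/-- The active domain: the constants occurring in a database. -/
def activeDomain {σ : Schema} (D : Database σ) : Set Const :=
  {c | ∃ f ∈ D, ∃ i, f.args i = c}

/-- Boolean conjunctive queries with negated atoms and inequality atoms, all variables being
existentially quantified, subject to safe negation. -/
structure CQNeg (σ : Schema) where
  /-- the positive atoms -/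
  pos : List (Atom σ)
  /-- the atoms that occur negated -/
  neg : List (Atom σ)
  /-- the inequality atoms `t ≠ t'` -/
  ineq : List (QTerm × QTerm)
  safe_neg : ∀ a ∈ neg, ∀ x, a.HasVar x → ∃ b ∈ pos, b.HasVar x
  safe_ineq : ∀ e ∈ ineq, ∀ x, e.1 = .var x ∨ e.2 = .var x → ∃ b ∈ pos, b.HasVar x

/-- Finite unions (disjunctions) of such queries. -/
abbrev UCQNeg (σ : Schema) : Type := List (CQNeg σ)

/-- The valuation `ν` makes the conjunction true on a set of facts. -/
def CQNeg.SatBy {σ : Schema} (F : Set (DBFact σ)) (p : CQNeg σ) (ν : Var → Const) : Prop :=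
  (∀ a ∈ p.pos, a.eval ν ∈ F) ∧ (∀ a ∈ p.neg, a.eval ν ∉ F) ∧
    ∀ e ∈ p.ineq, e.1.eval ν ≠ e.2.eval ν

/-- A Boolean query holds in a set of facts. -/
def UCQNeg.Holds {σ : Schema} (F : Set (DBFact σ)) (q : UCQNeg σ) : Prop :=
  ∃ p ∈ q, ∃ ν : Var → Const, p.SatBy F ν

/-- The constants occurring in a query. -/
def UCQNeg.consts {σ : Schema} (q : UCQNeg σ) : Set Const :=
  {c | ∃ p ∈ q, (∃ a ∈ p.pos, ∃ i, a.args i = .const c) ∨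
    (∃ a ∈ p.neg, ∃ i, a.args i = .const c) ∨
    ∃ e ∈ p.ineq, e.1 = .const c ∨ e.2 = .const c}

/-! ## Signed facts and positive supports -/

/-- The signed schema, with two copies `+R` (left) and `-R` (right) of each symbol `R`. -/
def Schema.signed (σ : Schema) : Schema where
  Rel := σ.Rel ⊕ σ.Rel
  finite_rel := by
    have := σ.finite_rel
    infer_instance
  arity := Sum.elim σ.arity σ.arity
  arity_pos := by
    rintro (R | R)
    · exact σ.arity_pos R
    · exact σ.arity_pos R

/-- The signed atom `+R(t)`. -/
def Atom.plus {σ : Schema} (a : Atom σ) : Atom σ.signed := ⟨Sum.inl a.rel, a.args⟩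

/-- The signed atom `-R(t)`. -/
def Atom.minus {σ : Schema} (a : Atom σ) : Atom σ.signed := ⟨Sum.inr a.rel, a.args⟩

/-- The signed fact `+R(c)`. -/
def DBFact.plus {σ : Schema} (f : DBFact σ) : DBFact σ.signed := ⟨Sum.inl f.rel, f.args⟩

/-- The signed fact `-R(c)`. -/
def DBFact.minus {σ : Schema} (f : DBFact σ) : DBFact σ.signed := ⟨Sum.inr f.rel, f.args⟩

/-- The query over the signed schema in which `R(t)` becomes `+R(t)` and `¬ R(t)` becomes
the non-negated atom `-R(t)`. -/
def CQNeg.signed {σ : Schema} (p : CQNeg σ) : CQNeg σ.signed where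
  pos := p.pos.map Atom.plus ++ p.neg.map Atom.minus
  neg := []
  ineq := p.ineq
  safe_neg := by simp
  safe_ineq := by
    intro e he x hx
    obtain ⟨b, hb, hbx⟩ := p.safe_ineq e he x hx
    exact ⟨b.plus, List.mem_append_left _ (List.mem_map_of_mem hb), hbx⟩

/-- The signed version of a union of conjunctive queries. -/
def UCQNeg.signed {σ : Schema} (q : UCQNeg σ) : UCQNeg σ.signed := List.map CQNeg.signed q

/-- The signed database: `+f` for every fact `f` of `D`, and `-f` for every absent fact `f` over
the active domain of `D`. -/
def signedDatabase {σ : Schema} (D : Database σ) : Set (DBFact σ.signed) :=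
  DBFact.plus '' {f | f ∈ D} ∪ DBFact.minus '' {f | (∀ i, f.args i ∈ activeDomain D) ∧ f ∉ D}

/-- The unsigned facts that appear negatively in a set of signed facts. -/
def negPart {σ : Schema} (F : Set (DBFact σ.signed)) : Set (DBFact σ) := {f | f.minus ∈ F}

/-- `S ⊆ D` is a positive support of `q` in `D` if the positive copy of `S` together with all
negative facts of the signed version of `D` satisfies the signed version of `q`. -/
def IsPositiveSupport {σ : Schema} (q : UCQNeg σ) (D S : Database σ) : Prop :=
  S ⊆ D ∧ q.signed.Holds (DBFact.plus '' {f | f ∈ S} ∪ DBFact.minus '' negPart (signedDatabase D))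

/-- A fact is positive-relevant if it belongs to some inclusion-minimal positive support. -/
def PositiveRelevant {σ : Schema} (q : UCQNeg σ) (D : Database σ) (α : DBFact σ) : Prop :=
  ∃ S : Database σ, Minimal (IsPositiveSupport q D) S ∧ α ∈ S

/-! ## First-order formulas evaluated on a database -/

/-- The first-order language with the relation symbols of `σ` and a constant symbol for each
element of `K`. -/
def schemaLanguage (σ : Schema) (K : Set Const) : FirstOrder.Language where
  Functions n := {_c : K // n = 0}
  Relations n := {R : σ.Rel // σ.arity R = n}

/-- The domain over which formulas are evaluated on `D`: the active domain of `D`, together with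
the named constants. -/
def EvalDomain {σ : Schema} (D : Database σ) (K : Set Const) : Type :=
  {c : Const // c ∈ activeDomain D ∨ c ∈ K}

/-- A database as a first-order structure. -/
instance databaseStructure {σ : Schema} (D : Database σ) (K : Set Const) :
    (schemaLanguage σ K).Structure (EvalDomain D K) where
  funMap f _ := ⟨f.1.1, Or.inr f.1.2⟩
  RelMap R v := (⟨R.1, fun i => (v (Fin.cast R.2 i)).1⟩ : DBFact σ) ∈ D

/-- The arguments of a fact of `D`, as elements of the evaluation domain. -/
def factArgs {σ : Schema} {D : Database σ} (K : Set Const) {α : DBFact σ} (hα : α ∈ D) :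
    Fin (σ.arity α.rel) → EvalDomain D K :=
  fun i => ⟨α.args i, Or.inl ⟨α, hα, i, rfl⟩⟩

/-! ## Boolean circuits and uniform `AC⁰` -/

/-- Kinds of gates of a circuit reading words of length `n` over `Γ`: unbounded fan-in AND and OR,
negation, and input gates testing whether the letter at position `i` is `a`. -/
inductive GateKind (Γ : Type) (n : ℕ) : Type
  | and : GateKind Γ n
  | or : GateKind Γ n
  | not : GateKind Γ n
  | input (i : Fin n) (a : Γ) : GateKind Γ n

/-- Circuits reading words of length `n` over `Γ`. `wire g h` means that `h` is an input of `g`.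
Every wire strictly decreases `level`, so that the circuit is acyclic and the length of every path
starting at `g` is at most `level g`. -/
structure Circuit (Γ : Type) (n : ℕ) where
  Gate : Type
  fintypeGate : Fintype Gate
  kind : Gate → GateKind Γ n
  wire : Gate → Gate → Prop
  output : Gate
  level : Gate → ℕ
  level_lt : ∀ g h, wire g h → level h < level g
  not_fanin : ∀ g, kind g = .not → ∃! h, wire g h

/-- The number of gates. -/
def Circuit.size {Γ : Type} {n : ℕ} (C : Circuit Γ n) : ℕ :=
  @Fintype.card C.Gate C.fintypeGate

/-- The circuit has depth at most `d`. -/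
def Circuit.DepthLE {Γ : Type} {n : ℕ} (C : Circuit Γ n) (d : ℕ) : Prop :=
  ∀ g, C.level g ≤ d

/-- The value of a gate on an input word. -/
def Circuit.value {Γ : Type} {n : ℕ} (C : Circuit Γ n) (w : Fin n → Γ) (g : C.Gate) : Prop :=
  match C.kind g with
  | .and => ∀ h, ∀ _ : C.wire g h, C.value w h
  | .or => ∃ h, ∃ _ : C.wire g h, C.value w h
  | .not => ∀ h, ∀ _ : C.wire g h, ¬ C.value w h
  | .input i a => w i = a
termination_by C.level g
decreasing_by all_goals exact C.level_lt _ _ (by assumption)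

/-- The circuit accepts a word if its output gate is true. -/
def Circuit.Accepts {Γ : Type} {n : ℕ} (C : Circuit Γ n) (w : Fin n → Γ) : Prop :=
  C.value w C.output

/-- Relation symbols of arithmetic: the order and the graphs of addition and multiplication. -/
inductive ArithRel : ℕ → Type
  | le : ArithRel 2
  | add : ArithRel 3
  | mul : ArithRel 3

/-- The first-order language of `≤`, `+`, `×` (as relations). -/
def arithLanguage : FirstOrder.Language := ⟨fun _ => Empty, ArithRel⟩

/-- The initial segment `{0, …, m - 1}` with its order, addition and multiplication. -/
instance arithStructure (m : ℕ) : arithLanguage.Structure (Fin m) where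
  funMap f _ := f.elim
  RelMap {_} R := match R with
    | .le => fun v => (v 0 : ℕ) ≤ v 1
    | .add => fun v => (v 0 : ℕ) + v 1 = v 2
    | .mul => fun v => (v 0 : ℕ) * v 1 = v 2

/-- A sequence of relations, the `n`-th one on `{0, …, n}`, is defined by one first-order formula
over `≤`, `+`, `×`. -/
def FODefinable {ι : Type} (P : ∀ n : ℕ, (ι → Fin (n + 1)) → Prop) : Prop :=
  ∃ φ : arithLanguage.Formula ι, ∀ (n : ℕ) (v : ι → Fin (n + 1)), φ.Realize v ↔ P n v

/-- First-order uniformity of a family of circuits: the gates of the `n`-th circuit can be named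
by a tag from a fixed finite set and a tuple of fixed length over `{0, …, n}` in such a way that
the set of gates, their kinds, the wires and the output gate are first-order definable over
`≤`, `+`, `×`. -/
def FOUniform {Γ : Type} (C : ∀ n, Circuit Γ n) : Prop :=
  ∃ (t k : ℕ) (name : ∀ n, (C n).Gate ↪ Fin t × (Fin k → Fin (n + 1))),
    (∀ i, FODefinable fun n (x : Fin k → Fin (n + 1)) => ∃ g, name n g = (i, x)) ∧
    (∀ i, FODefinable fun n (x : Fin k → Fin (n + 1)) =>
      ∃ g, name n g = (i, x) ∧ (C n).kind g = .and) ∧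
    (∀ i, FODefinable fun n (x : Fin k → Fin (n + 1)) =>
      ∃ g, name n g = (i, x) ∧ (C n).kind g = .or) ∧
    (∀ i, FODefinable fun n (x : Fin k → Fin (n + 1)) =>
      ∃ g, name n g = (i, x) ∧ (C n).kind g = .not) ∧
    (∀ i a, FODefinable fun n (x : Fin k ⊕ Unit → Fin (n + 1)) =>
      ∃ (g : (C n).Gate) (j : Fin n), name n g = (i, fun l => x (Sum.inl l)) ∧
        (x (Sum.inr ()) : ℕ) = j ∧ (C n).kind g = .input j a) ∧
    (∀ i i', FODefinable fun n (x : Fin k ⊕ Fin k → Fin (n + 1)) =>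
      ∃ g h, name n g = (i, fun l => x (Sum.inl l)) ∧ name n h = (i', fun l => x (Sum.inr l)) ∧
        (C n).wire g h) ∧
    (∀ i, FODefinable fun n (x : Fin k → Fin (n + 1)) => name n (C n).output = (i, x))

/-- Uniform `AC⁰`: languages decided by a first-order uniform family of circuits of polynomial
size and bounded depth with unbounded fan-in. -/
def InAC0 {Γ : Type} [Finite Γ] (L : Language Γ) : Prop :=
  ∃ C : ∀ n, Circuit Γ n,
    (∃ P : Polynomial ℕ, ∀ n, (C n).size ≤ P.eval n) ∧
    (∃ d : ℕ, ∀ n, (C n).DepthLE d) ∧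
    FOUniform C ∧
    ∀ w : List Γ, w ∈ L ↔ (C w.length).Accepts w.get

/-! ## The decision problem -/

/-- The alphabet in which databases are written: the two bits, an end marker for constants
(`none`), and the relation symbols. -/
abbrev DBSymbol (σ : Schema) : Type := Option Bool ⊕ σ.Rel

instance finiteDBSymbol (σ : Schema) : Finite (DBSymbol σ) := by
  have := σ.finite_rel
  infer_instance

/-- A constant is written as the sequence of its bits, followed by the end marker. -/
def encodeConst (σ : Schema) (c : Const) : List (DBSymbol σ) :=
  c.map (fun b => Sum.inl (some b)) ++ [Sum.inl none]

/-- A fact is written as its relation symbol followed by its arguments. -/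
def encodeFact {σ : Schema} (f : DBFact σ) : List (DBSymbol σ) :=
  Sum.inr f.rel :: (List.ofFn f.args).flatMap (encodeConst σ)

/-- The word `w` represents the instance `(D, α)`: it is `α` followed by a list of the facts of
`D`, in any order and possibly with repetitions. -/
def Represents {σ : Schema} (w : List (DBSymbol σ)) (D : Database σ) (α : DBFact σ) : Prop :=
  ∃ l : List (DBFact σ), (∀ f, f ∈ l ↔ f ∈ D) ∧ w = encodeFact α ++ l.flatMap encodeFact

/-- The positive-relevance problem for the fixed query `q`: the representations of the pairs
`(D, α)` such that `α ∈ D` is positive-relevant for `q` in `D`. -/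
def relevanceLanguage {σ : Schema} (q : UCQNeg σ) : Language (DBSymbol σ) :=
  {w | ∃ (D : Database σ) (α : DBFact σ), Represents w D α ∧ α ∈ D ∧ PositiveRelevant q D α}

/-!
The inclusion-minimal positive supports are the inclusion-minimal ones among the sets of positive
facts of matches: a match sends the variables of a disjunct to constants so that the positive atoms
become facts of the database and the negated atoms become facts over the active domain that are
absent. It is given by the values of boundedly many variables, all of them in the active domain, so
"`α` lies in a match that contains no strictly smaller match" is first-order in every structure
whose elements name the constants of the active domain and in which the membership of facts and the
equality of names are definable.

The database itself, with its evaluation domain, is such a structure. So is a word: a position names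
the constant whose bits start there, and two names agree if they agree at every offset, which is
first-order with addition. Hence the language is defined by a first-order sentence with arithmetic
over words, and such a sentence is decided by circuits with one gate for every subformula and
assignment of positions to its variables.
-/

/-! ## Uniform first-order definability -/

/-- A family of relations on structures `M x` is uniformly definable if one first-order formula
defines the relation `P x` in `M x` for all indices `x`. -/
def UniformlyDefinable (L : FirstOrder.Language) {X : Type*} (M : X → Type*)
    [∀ x, L.Structure (M x)] {ι : Type*} (P : ∀ x, (ι → M x) → Prop) : Prop :=
  ∃ φ : L.Formula ι, ∀ x v, φ.Realize v ↔ P x v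

namespace UniformlyDefinable

open FirstOrder.Language

variable {L : FirstOrder.Language} {X : Type*} {M : X → Type*} [∀ x, L.Structure (M x)]
  {ι κ α : Type*} {P Q : ∀ x, (ι → M x) → Prop}

theorem congr (hP : UniformlyDefinable L M P) (h : ∀ x v, Q x v ↔ P x v) :
    UniformlyDefinable L M Q := by
  obtain ⟨φ, hφ⟩ := hP
  exact ⟨φ, fun x v => (hφ x v).trans (h x v).symm⟩

theorem reindex (hP : UniformlyDefinable L M P) (f : ι → κ) :
    UniformlyDefinable L M fun x (v : κ → M x) => P x fun i => v (f i) := by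
  obtain ⟨φ, hφ⟩ := hP
  exact ⟨φ.relabel f, fun x v => Formula.realize_relabel.trans (hφ x _)⟩

theorem const (p : Prop) : UniformlyDefinable L M fun x (_ : ι → M x) => p := by
  by_cases h : p
  · exact ⟨⊤, fun x v => by simp [h]⟩
  · exact ⟨⊥, fun x v => by simp [h]⟩

theorem not (hP : UniformlyDefinable L M P) : UniformlyDefinable L M fun x v => ¬ P x v := by
  obtain ⟨φ, hφ⟩ := hP
  exact ⟨φ.not, fun x v => by rw [Formula.realize_not, hφ]⟩

theorem and (hP : UniformlyDefinable L M P) (hQ : UniformlyDefinable L M Q) :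
    UniformlyDefinable L M fun x v => P x v ∧ Q x v := by
  obtain ⟨φ, hφ⟩ := hP
  obtain ⟨ψ, hψ⟩ := hQ
  exact ⟨φ ⊓ ψ, fun x v => by rw [Formula.realize_inf, hφ, hψ]⟩

theorem or (hP : UniformlyDefinable L M P) (hQ : UniformlyDefinable L M Q) :
    UniformlyDefinable L M fun x v => P x v ∨ Q x v := by
  obtain ⟨φ, hφ⟩ := hP
  obtain ⟨ψ, hψ⟩ := hQ
  exact ⟨φ ⊔ ψ, fun x v => by rw [Formula.realize_sup, hφ, hψ]⟩

theorem imp (hP : UniformlyDefinable L M P) (hQ : UniformlyDefinable L M Q) :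
    UniformlyDefinable L M fun x v => P x v → Q x v := by
  obtain ⟨φ, hφ⟩ := hP
  obtain ⟨ψ, hψ⟩ := hQ
  exact ⟨φ.imp ψ, fun x v => by rw [Formula.realize_imp, hφ, hψ]⟩

theorem iff (hP : UniformlyDefinable L M P) (hQ : UniformlyDefinable L M Q) :
    UniformlyDefinable L M fun x v => (P x v ↔ Q x v) := by
  obtain ⟨φ, hφ⟩ := hP
  obtain ⟨ψ, hψ⟩ := hQ
  exact ⟨φ.iff ψ, fun x v => by rw [Formula.realize_iff, hφ, hψ]⟩

theorem eq (i j : ι) : UniformlyDefinable L M fun _ v => v i = v j :=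
  ⟨(Term.var i).equal (Term.var j), fun _ _ => Formula.realize_equal⟩

theorem iExs [Finite κ] {P : ∀ x, (ι → M x) → (κ → M x) → Prop}
    (hP : UniformlyDefinable L M fun x (v : ι ⊕ κ → M x) =>
      P x (fun i => v (Sum.inl i)) fun i => v (Sum.inr i)) :
    UniformlyDefinable L M fun x v => ∃ u, P x v u := by
  obtain ⟨φ, hφ⟩ := hP
  exact ⟨φ.iExs κ, fun x v => Formula.realize_iExs.trans (exists_congr fun u => hφ x _)⟩

theorem exists_tuple [Finite κ] {P : ∀ x, (κ → M x) → Prop} (hP : UniformlyDefinable L M P) :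
    UniformlyDefinable L M fun x (_ : ι → M x) => ∃ u, P x u :=
  iExs (P := fun x _ u => P x u) (hP.reindex Sum.inr)

theorem iAlls [Finite κ] {P : ∀ x, (ι → M x) → (κ → M x) → Prop}
    (hP : UniformlyDefinable L M fun x (v : ι ⊕ κ → M x) =>
      P x (fun i => v (Sum.inl i)) fun i => v (Sum.inr i)) :
    UniformlyDefinable L M fun x v => ∀ u, P x v u := by
  obtain ⟨φ, hφ⟩ := hP
  exact ⟨φ.iAlls κ, fun x v => Formula.realize_iAlls.trans (forall_congr' fun u => hφ x _)⟩

theorem ex {P : ∀ x, (ι → M x) → M x → Prop}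
    (hP : UniformlyDefinable L M fun x (v : ι ⊕ Unit → M x) =>
      P x (fun i => v (Sum.inl i)) (v (Sum.inr ()))) :
    UniformlyDefinable L M fun x v => ∃ a, P x v a :=
  (iExs (P := fun x v u => P x v (u ())) hP).congr fun _ _ =>
    ⟨fun ⟨a, h⟩ => ⟨fun _ => a, h⟩, fun ⟨u, h⟩ => ⟨u (), h⟩⟩

theorem all {P : ∀ x, (ι → M x) → M x → Prop}
    (hP : UniformlyDefinable L M fun x (v : ι ⊕ Unit → M x) =>
      P x (fun i => v (Sum.inl i)) (v (Sum.inr ()))) :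
    UniformlyDefinable L M fun x v => ∀ a, P x v a :=
  (iAlls (P := fun x v u => P x v (u ())) hP).congr fun _ _ =>
    ⟨fun h u => h (u ()), fun h a => h fun _ => a⟩

theorem exists_mem (l : List α) {P : α → ∀ x, (ι → M x) → Prop}
    (hP : ∀ a ∈ l, UniformlyDefinable L M (P a)) :
    UniformlyDefinable L M fun x v => ∃ a ∈ l, P a x v := by
  induction l with
  | nil => exact (const False).congr fun x v => by simp
  | cons b l ih =>
    rw [List.forall_mem_cons] at hP
    exact (hP.1.or (ih hP.2)).congr fun x v => by simp

theorem forall_mem (l : List α) {P : α → ∀ x, (ι → M x) → Prop}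
    (hP : ∀ a ∈ l, UniformlyDefinable L M (P a)) :
    UniformlyDefinable L M fun x v => ∀ a ∈ l, P a x v :=
  (exists_mem l fun a ha => (hP a ha).not).not.congr fun x v => by simp

theorem exists_finite [Finite α] {P : α → ∀ x, (ι → M x) → Prop}
    (hP : ∀ a, UniformlyDefinable L M (P a)) :
    UniformlyDefinable L M fun x v => ∃ a, P a x v := by
  have := Fintype.ofFinite α
  exact (exists_mem Finset.univ.toList fun a _ => hP a).congr fun x v => by simp

theorem forall_finite [Finite α] {P : α → ∀ x, (ι → M x) → Prop}
    (hP : ∀ a, UniformlyDefinable L M (P a)) :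
    UniformlyDefinable L M fun x v => ∀ a, P a x v :=
  (exists_finite fun a => (hP a).not).not.congr fun x v => by simp

end UniformlyDefinable

section Arithmetic

open UniformlyDefinable

variable {ι : Type}

theorem foDefinable_le (i j : ι) : FODefinable fun _ v => v i ≤ v j :=
  ⟨FirstOrder.Language.Relations.formula₂ (L := arithLanguage)
      (show arithLanguage.Relations 2 from ArithRel.le) (.var i) (.var j),
    fun _ _ => FirstOrder.Language.Formula.realize_rel₂⟩

theorem foDefinable_add (i j l : ι) : FODefinable fun _ v => (v i : ℕ) + v j = v l :=
  ⟨FirstOrder.Language.Relations.formula (L := arithLanguage) (n := 3)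
      (show arithLanguage.Relations 3 from ArithRel.add) ![.var i, .var j, .var l],
    fun _ _ => FirstOrder.Language.Formula.realize_rel⟩

theorem foDefinable_lt (i j : ι) : FODefinable fun _ v => v i < v j :=
  (UniformlyDefinable.not (foDefinable_le j i)).congr fun _ _ => not_le.symm

theorem foDefinable_eq_zero (i : ι) : FODefinable fun _ v => v i = 0 :=
  (all (P := fun _ v a => v i ≤ a) (foDefinable_le _ _)).congr fun _ _ => isBot_iff_eq_bot.symm

theorem foDefinable_eq_last (i : ι) : FODefinable fun n v => v i = Fin.last n :=
  (all (P := fun _ v a => a ≤ v i) (foDefinable_le _ _)).congr fun _ _ => isTop_iff_eq_top.symm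

theorem foDefinable_lt_last (i : ι) : FODefinable fun n v => (v i : ℕ) < n :=
  (UniformlyDefinable.not (foDefinable_eq_last i)).congr fun _ _ => Fin.lt_last_iff_ne_last

theorem foDefinable_covBy (i j : ι) : FODefinable fun _ v => v i ⋖ v j :=
  UniformlyDefinable.and (foDefinable_lt i j)
    (all (P := fun _ v a => v i < a → ¬ a < v j)
      (imp (foDefinable_lt _ _) (UniformlyDefinable.not (foDefinable_lt _ _))))

end Arithmetic

/-! ## First-order queries on words are decided by uniform circuits -/

namespace Circuit

variable {Γ : Type} {n : ℕ}

/-- The value of the gate `g` computed from prescribed values `V` of its inputs. -/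
def localValue (C : Circuit Γ n) (w : Fin n → Γ) (V : C.Gate → Prop) (g : C.Gate) : Prop :=
  match C.kind g with
  | .and => ∀ h, C.wire g h → V h
  | .or => ∃ h, C.wire g h ∧ V h
  | .not => ∀ h, C.wire g h → ¬ V h
  | .input i a => w i = a

theorem value_iff_of_localValue_iff {C : Circuit Γ n} {w : Fin n → Γ} {V : C.Gate → Prop}
    (hV : ∀ g, C.localValue w V g ↔ V g) (g : C.Gate) : C.value w g ↔ V g := by
  rw [← hV, Circuit.value, localValue]
  have ih (h : C.Gate) (_ : C.wire g h) : C.value w h ↔ V h := value_iff_of_localValue_iff hV h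
  split
  · exact forall₂_congr ih
  · simp only [exists_prop]
    exact exists_congr fun h => and_congr_right (ih h)
  · exact forall₂_congr fun h hgh => not_congr (ih h hgh)
  · rfl
termination_by C.level g
decreasing_by exact C.level_lt _ _ (by assumption)

end Circuit

/-- First-order queries on words over `Γ`, with the `k` registers ranging over `{0, …, n}` where
`n` is the length of the word. Purely arithmetical conditions are atomic, because the gates that
evaluate them are constant. -/
inductive WordQuery (Γ : Type) (k : ℕ) : Type
  | arith (φ : arithLanguage.Formula (Fin k)) : WordQuery Γ k
  | letter (a : Γ) (i : Fin k) : WordQuery Γ k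
  | not (φ : WordQuery Γ k) : WordQuery Γ k
  | and (φ ψ : WordQuery Γ k) : WordQuery Γ k
  | all (i : Fin k) (φ : WordQuery Γ k) : WordQuery Γ k

namespace WordQuery

variable {Γ : Type} {k n : ℕ} {χ φ ψ : WordQuery Γ k} {x y : Fin k → Fin (n + 1)}

/-- The truth of a query on a word, for given values of the registers. -/
def Realize (w : Fin n → Γ) : WordQuery Γ k → (Fin k → Fin (n + 1)) → Prop
  | arith φ, x => φ.Realize x
  | letter a i, x => ∃ h : (x i : ℕ) < n, w ⟨x i, h⟩ = a
  | not φ, x => ¬ φ.Realize w x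
  | and φ ψ, x => φ.Realize w x ∧ ψ.Realize w x
  | all i φ, x => ∀ b, φ.Realize w (Function.update x i b)

/-- The height of the syntax tree. -/
def height : WordQuery Γ k → ℕ
  | arith _ => 0
  | letter _ _ => 0
  | not φ => φ.height + 1
  | and φ ψ => max φ.height ψ.height + 1
  | all _ φ => φ.height + 1

/-- The set of subqueries of a query, including the query itself. -/
def subqueries : WordQuery Γ k → Set (WordQuery Γ k)
  | arith φ => {arith φ}
  | letter a i => {letter a i}
  | not φ => insert (not φ) φ.subqueries
  | and φ ψ => insert (and φ ψ) (φ.subqueries ∪ ψ.subqueries)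
  | all i φ => insert (all i φ) φ.subqueries

theorem self_mem_subqueries (φ : WordQuery Γ k) : φ ∈ φ.subqueries := by
  cases φ <;> simp [subqueries]

theorem finite_subqueries (φ : WordQuery Γ k) : φ.subqueries.Finite := by
  induction φ with
  | arith φ => exact Set.finite_singleton _
  | letter a i => exact Set.finite_singleton _
  | not φ ih => exact ih.insert _
  | and φ ψ ih ih' => exact (ih.union ih').insert _
  | all i φ ih => exact ih.insert _

theorem subqueries_subset_of_mem (h : φ ∈ χ.subqueries) : φ.subqueries ⊆ χ.subqueries := by
  induction χ with
  | arith _ | letter _ _ => rw [Set.mem_singleton_iff.1 h]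
  | not χ ih | all i χ ih =>
    rcases h with rfl | h
    · rfl
    · exact (ih h).trans (Set.subset_insert _ _)
  | and χ χ' ih ih' =>
    rcases h with rfl | h | h
    · rfl
    · exact (ih h).trans (Set.subset_union_left.trans (Set.subset_insert _ _))
    · exact (ih' h).trans (Set.subset_union_right.trans (Set.subset_insert _ _))

theorem height_le_of_mem_subqueries (h : φ ∈ χ.subqueries) : φ.height ≤ χ.height := by
  induction χ with
  | arith _ | letter _ _ => rw [Set.mem_singleton_iff.1 h]
  | not χ ih | all i χ ih =>
    rcases h with rfl | h
    · rfl
    · exact (ih h).trans (Nat.le_succ _)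
  | and χ χ' ih ih' =>
    rcases h with rfl | h | h
    · rfl
    · exact (ih h).trans ((le_max_left _ _).trans (Nat.le_succ _))
    · exact (ih' h).trans ((le_max_right _ _).trans (Nat.le_succ _))

/-- The truth of `φ` at the registers `x` depends immediately on that of `ψ` at the registers
`y`. -/
def Child : WordQuery Γ k → WordQuery Γ k → (Fin k → Fin (n + 1)) → (Fin k → Fin (n + 1)) → Prop
  | arith _, _, _, _ => False
  | letter _ _, _, _, _ => False
  | not φ, ψ, x, y => ψ = φ ∧ y = x
  | and φ φ', ψ, x, y => (ψ = φ ∨ ψ = φ') ∧ y = x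
  | all i φ, ψ, x, y => ψ = φ ∧ ∃ b, y = Function.update x i b

theorem Child.height_lt (h : Child φ ψ x y) : ψ.height < φ.height := by
  cases φ with
  | arith _ | letter _ _ => exact h.elim
  | not φ | all i φ => exact h.1 ▸ Nat.lt_succ_self _
  | and φ φ' =>
    rcases h.1 with rfl | rfl
    · exact Nat.lt_succ_of_le (le_max_left _ _)
    · exact Nat.lt_succ_of_le (le_max_right _ _)

theorem Child.mem_subqueries (h : Child φ ψ x y) : ψ ∈ φ.subqueries := by
  cases φ with
  | arith _ | letter _ _ => exact h.elim
  | not φ | all i φ => exact Or.inr (h.1 ▸ self_mem_subqueries _)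
  | and φ φ' =>
    rcases h.1 with rfl | rfl
    · exact Or.inr (Or.inl (self_mem_subqueries _))
    · exact Or.inr (Or.inr (self_mem_subqueries _))

open Classical in
/-- The kind of the gate that evaluates a query for given values of the registers. Gates of
arithmetical conditions have no inputs, so that AND is true and OR is false there. -/
noncomputable def gateKind (n : ℕ) : WordQuery Γ k → (Fin k → Fin (n + 1)) → GateKind Γ n
  | arith φ, x => if φ.Realize x then .and else .or
  | letter a i, x => if h : (x i : ℕ) < n then .input ⟨x i, h⟩ a else .or
  | not _, _ => .not
  | and _ _, _ => .and
  | all _ _, _ => .and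

theorem exists_child_iff_of_gateKind_eq_not (h : gateKind n φ x = .not) :
    ∃ ψ ∈ φ.subqueries, ∀ ψ' y, Child φ ψ' x y ↔ ψ' = ψ ∧ y = x := by
  cases φ with
  | arith φ => simp only [gateKind] at h; split_ifs at h
  | letter a i => simp only [gateKind] at h; split_ifs at h
  | not φ => exact ⟨φ, Or.inr φ.self_mem_subqueries, fun _ _ => Iff.rfl⟩
  | and φ φ' => simp [gateKind] at h
  | all i φ => simp [gateKind] at h

open Classical in
/-- The circuit that evaluates a query on the words of length `n`: its gates are the subqueries
together with values of the registers. -/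
noncomputable def circuit (χ : WordQuery Γ k) (n : ℕ) : Circuit Γ n where
  Gate := χ.subqueries × (Fin k → Fin (n + 1))
  fintypeGate := by
    have := χ.finite_subqueries.fintype
    infer_instance
  kind g := gateKind n g.1 g.2
  wire g h := Child g.1.1 h.1.1 g.2 h.2
  output := (⟨χ, χ.self_mem_subqueries⟩, 0)
  level g := g.1.1.height
  level_lt _ _ h := h.height_lt
  not_fanin g hg := by
    obtain ⟨ψ, hψ, h⟩ := exists_child_iff_of_gateKind_eq_not hg
    exact ⟨(⟨ψ, subqueries_subset_of_mem g.1.2 hψ⟩, g.2), (h _ _).2 ⟨rfl, rfl⟩,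
      fun g' hg' => Prod.ext (Subtype.ext ((h _ _).1 hg').1) ((h _ _).1 hg').2⟩

theorem localValue_circuit (χ : WordQuery Γ k) (w : Fin n → Γ) (g : (χ.circuit n).Gate) :
    (χ.circuit n).localValue w (fun h => h.1.1.Realize w h.2) g ↔ g.1.1.Realize w g.2 := by
  obtain ⟨⟨φ, hφ⟩, x⟩ := g
  have mem {ψ y} (h : Child φ ψ x y) : ψ ∈ χ.subqueries :=
    subqueries_subset_of_mem hφ h.mem_subqueries
  simp only [Circuit.localValue, circuit, Prod.forall, Prod.exists, Subtype.forall, Subtype.exists]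
  cases φ with
  | arith φ => by_cases h : φ.Realize x <;> simp [gateKind, Child, Realize, h]
  | letter a i => by_cases h : (x i : ℕ) < n <;> simp [gateKind, Child, Realize, h]
  | not φ =>
    exact ⟨fun H => H φ (mem ⟨rfl, rfl⟩) x ⟨rfl, rfl⟩, fun H _ _ _ h => h.1 ▸ h.2 ▸ H⟩
  | and φ φ' =>
    refine ⟨fun H => ⟨H φ (mem ⟨Or.inl rfl, rfl⟩) x ⟨Or.inl rfl, rfl⟩,
      H φ' (mem ⟨Or.inr rfl, rfl⟩) x ⟨Or.inr rfl, rfl⟩⟩, ?_⟩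
    rintro H _ _ _ ⟨rfl | rfl, rfl⟩
    exacts [H.1, H.2]
  | all i φ =>
    refine ⟨fun H b => H φ (mem ⟨rfl, b, rfl⟩) _ ⟨rfl, b, rfl⟩, ?_⟩
    rintro H _ _ _ ⟨rfl, b, rfl⟩
    exact H b

theorem accepts_circuit (χ : WordQuery Γ k) (w : Fin n → Γ) :
    (χ.circuit n).Accepts w ↔ χ.Realize w 0 :=
  Circuit.value_iff_of_localValue_iff (χ.localValue_circuit w) _

theorem size_circuit (χ : WordQuery Γ k) (n : ℕ) :
    (χ.circuit n).size = Nat.card χ.subqueries * (n + 1) ^ k := by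
  have h : (χ.circuit n).size = Nat.card (χ.subqueries × (Fin k → Fin (n + 1))) :=
    (@Nat.card_eq_fintype_card _ (χ.circuit n).fintypeGate).symm
  rw [h, Nat.card_prod]
  simp

open UniformlyDefinable

theorem foDefinable_child (φ ψ : WordQuery Γ k) :
    FODefinable fun n (v : Fin k ⊕ Fin k → Fin (n + 1)) =>
      Child φ ψ (fun l => v (Sum.inl l)) fun l => v (Sum.inr l) := by
  cases φ with
  | arith _ | letter _ _ => exact UniformlyDefinable.const False
  | not φ =>
    exact (UniformlyDefinable.and (const (ψ = φ))
      (forall_finite fun l => eq (Sum.inr l) (Sum.inl l))).congr fun n v => by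
        simp [Child, funext_iff]
  | and φ φ' =>
    exact (UniformlyDefinable.and (const (ψ = φ ∨ ψ = φ'))
      (forall_finite fun l => eq (Sum.inr l) (Sum.inl l))).congr fun n v => by
        simp [Child, funext_iff]
  | all i φ =>
    exact (UniformlyDefinable.and (const (ψ = φ)) (forall_finite fun l =>
      imp (const (l ≠ i)) (eq (Sum.inr l) (Sum.inl l)))).congr fun n v => by
        simp [Child, Function.eq_update_iff]

theorem foDefinable_gateKind {ι : Type} {P : ∀ n, GateKind Γ n → (ι → Fin (n + 1)) → Prop}
    (hand : FODefinable fun n => P n .and) (hor : FODefinable fun n => P n .or)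
    (hnot : FODefinable fun n => P n .not)
    (hinput : ∀ a (i : ι), FODefinable fun n v => ∃ h : (v i : ℕ) < n, P n (.input ⟨v i, h⟩ a) v)
    (φ : WordQuery Γ k) (f : Fin k → ι) :
    FODefinable fun n v => P n (gateKind n φ fun l => v (f l)) v := by
  cases φ with
  | arith φ =>
    have hφ : FODefinable fun n (v : ι → Fin (n + 1)) => φ.Realize fun l => v (f l) :=
      UniformlyDefinable.reindex ⟨φ, fun _ _ => Iff.rfl⟩ f
    refine (UniformlyDefinable.or (UniformlyDefinable.and hφ hand)
      (UniformlyDefinable.and (UniformlyDefinable.not hφ) hor)).congr fun n v => ?_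
    by_cases h : φ.Realize fun l => v (f l) <;> simp [gateKind, h]
  | letter a i =>
    refine (UniformlyDefinable.or (hinput a (f i)) (UniformlyDefinable.and
      (UniformlyDefinable.not (foDefinable_lt_last (f i))) hor)).congr fun n v => ?_
    by_cases h : (v (f i) : ℕ) < n <;> simp [gateKind, h]
  | not φ => exact hnot
  | and φ φ' => exact hand
  | all i φ => exact hand

theorem foDefinable_gateKind_eq_and (φ : WordQuery Γ k) :
    FODefinable fun n x => gateKind n φ x = .and :=
  foDefinable_gateKind (P := fun _ K _ => K = .and) (const (ι := Fin k) True |>.congr (by simp))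
    (const False |>.congr (by simp)) (const False |>.congr (by simp))
    (fun _ _ => const False |>.congr (by simp)) φ id

theorem foDefinable_gateKind_eq_or (φ : WordQuery Γ k) :
    FODefinable fun n x => gateKind n φ x = .or :=
  foDefinable_gateKind (P := fun _ K _ => K = .or) (const False |>.congr (by simp))
    (const True |>.congr (by simp)) (const False |>.congr (by simp))
    (fun _ _ => const False |>.congr (by simp)) φ id

theorem foDefinable_gateKind_eq_not (φ : WordQuery Γ k) :
    FODefinable fun n x => gateKind n φ x = .not :=
  foDefinable_gateKind (P := fun _ K _ => K = .not) (const False |>.congr (by simp))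
    (const False |>.congr (by simp)) (const True |>.congr (by simp))
    (fun _ _ => const False |>.congr (by simp)) φ id

theorem foDefinable_gateKind_eq_input (φ : WordQuery Γ k) (a : Γ) :
    FODefinable fun n (v : Fin k ⊕ Unit → Fin (n + 1)) => ∃ j : Fin n,
      (v (Sum.inr ()) : ℕ) = j ∧ gateKind n φ (fun l => v (Sum.inl l)) = .input j a := by
  refine foDefinable_gateKind (P := fun n K v => ∃ j : Fin n, (v (Sum.inr ()) : ℕ) = j ∧
    K = .input j a) (const False |>.congr (by simp)) (const False |>.congr (by simp))
    (const False |>.congr (by simp)) (fun b i => ?_) φ Sum.inl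
  refine (UniformlyDefinable.and (const (b = a)) (UniformlyDefinable.and (foDefinable_lt_last i)
    (eq (Sum.inr ()) i))).congr fun n v => ?_
  constructor
  · rintro ⟨h, j, hj, hK⟩
    obtain ⟨rfl, rfl⟩ := GateKind.input.inj hK
    exact ⟨rfl, h, Fin.ext hj⟩
  · rintro ⟨rfl, h, hv⟩
    exact ⟨h, ⟨v i, h⟩, congrArg Fin.val hv, rfl⟩

theorem foUniform_circuit (χ : WordQuery Γ k) : FOUniform χ.circuit := by
  have := χ.finite_subqueries.to_subtype
  obtain ⟨t, ⟨e⟩⟩ := Finite.exists_equiv_fin χ.subqueries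
  let name (n : ℕ) : (χ.circuit n).Gate ≃ Fin t × (Fin k → Fin (n + 1)) :=
    e.prodCongr (Equiv.refl _)
  have exists_gate (n : ℕ) (i x) (Q : (χ.circuit n).Gate → Prop) :
      (∃ g, name n g = (i, x) ∧ Q g) ↔ Q (e.symm i, x) := by
    simp only [← Equiv.eq_symm_apply, exists_eq_left]
    rfl
  refine ⟨t, k, fun n => (name n).toEmbedding, fun i => ?_, fun i => ?_, fun i => ?_, fun i => ?_,
    fun i a => ?_, fun i j => ?_, fun i => ?_⟩
  · exact (const True).congr fun n x => by simp [(name n).exists_congr_left]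
  · exact UniformlyDefinable.congr (foDefinable_gateKind_eq_and (e.symm i).1) fun n x =>
      exists_gate n i x _
  · exact UniformlyDefinable.congr (foDefinable_gateKind_eq_or (e.symm i).1) fun n x =>
      exists_gate n i x _
  · exact UniformlyDefinable.congr (foDefinable_gateKind_eq_not (e.symm i).1) fun n x =>
      exists_gate n i x _
  · refine UniformlyDefinable.congr (foDefinable_gateKind_eq_input (e.symm i).1 a) fun n x => ?_
    simp only [exists_and_left]
    exact exists_gate n i _ _
  · refine UniformlyDefinable.congr (foDefinable_child (e.symm i).1 (e.symm j).1) fun n x => ?_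
    simp only [exists_and_left]
    exact (exists_gate n i _ _).trans (exists_gate n j _ _)
  · refine (UniformlyDefinable.and (const (e ⟨χ, χ.self_mem_subqueries⟩ = i))
      (forall_finite foDefinable_eq_zero)).congr fun n x => ?_
    rw [← funext_iff, eq_comm (a := x)]
    exact Prod.mk_inj

theorem inAC0 [Finite Γ] {L : Language Γ} (χ : WordQuery Γ k)
    (hL : ∀ w : List Γ, w ∈ L ↔ χ.Realize w.get 0) : InAC0 L :=
  ⟨χ.circuit, ⟨Polynomial.C (Nat.card χ.subqueries) * (Polynomial.X + 1) ^ k,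
    fun n => by simp [size_circuit]⟩, ⟨χ.height, fun _ g => height_le_of_mem_subqueries g.1.2⟩,
    χ.foUniform_circuit, fun w => (hL w).trans (χ.accepts_circuit w.get).symm⟩

end WordQuery

/-! ## First-order sentences about words -/

/-- Relation symbols for words: those of arithmetic, and a unary one for every letter. -/
inductive WordRel (Γ : Type) : ℕ → Type
  | arith {m : ℕ} (R : ArithRel m) : WordRel Γ m
  | letter (a : Γ) : WordRel Γ 1

/-- The first-order language of words with arithmetic. -/
def wordLanguage (Γ : Type) : FirstOrder.Language := ⟨fun _ => Empty, WordRel Γ⟩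

/-- The positions of a word, including the one after the last letter, so that a first-order
formula over words can speak about `{0, …, n}` as in uniformity of circuits. -/
abbrev Position {Γ : Type} (w : List Γ) : Type := Fin (w.length + 1)

/-- A word as a first-order structure on its positions. -/
instance wordStructure {Γ : Type} (w : List Γ) : (wordLanguage Γ).Structure (Position w) where
  funMap f _ := f.elim
  RelMap {_} R := match R with
    | .arith R => FirstOrder.Language.Structure.RelMap (L := arithLanguage) R
    | .letter a => fun v => w[(v 0 : ℕ)]? = some a

/-- A relation between positions of words that is defined by one first-order formula with
arithmetic, uniformly in the word. -/
abbrev WordDefinable {Γ ι : Type} (P : ∀ w : List Γ, (ι → Position w) → Prop) : Prop :=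
  UniformlyDefinable (wordLanguage Γ) (fun w => Position w) P

section WordDefinable

open FirstOrder Language

variable {Γ ι : Type}

/-- The inclusion of the language of arithmetic in the language of words. -/
def arithInclusion (Γ : Type) : arithLanguage →ᴸ wordLanguage Γ where
  onFunction _ := Empty.elim
  onRelation _ R := WordRel.arith R

instance isExpansionOn_arithInclusion (w : List Γ) :
    (arithInclusion Γ).IsExpansionOn (Position w) where
  map_onFunction f := f.elim
  map_onRelation _ _ := rfl

theorem FODefinable.wordDefinable {P : ∀ n, (ι → Fin (n + 1)) → Prop} (hP : FODefinable P) :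
    WordDefinable fun (w : List Γ) v => P w.length v := by
  obtain ⟨φ, hφ⟩ := hP
  exact ⟨(arithInclusion Γ).onFormula φ, fun w v =>
    ((arithInclusion Γ).realize_onFormula φ).trans (hφ w.length v)⟩

theorem wordDefinable_getElem?_eq_some (a : Γ) (i : ι) :
    WordDefinable fun w v => w[(v i : ℕ)]? = some a :=
  ⟨Relations.formula₁ (L := wordLanguage Γ) (show (wordLanguage Γ).Relations 1 from .letter a)
    (.var i), fun _ _ => Formula.realize_rel₁⟩

end WordDefinable

namespace WordQuery

open FirstOrder Language

variable {Γ : Type} {m k : ℕ}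

/-- The query `χ`, with `k` registers, has the same meaning as the formula `φ`, whose free
variables are `m ≤ k` de Bruijn levels, stored in the first `m` registers. -/
def Expresses (hk : m ≤ k) (χ : WordQuery Γ k) (φ : (wordLanguage Γ).BoundedFormula Empty m) :
    Prop :=
  ∀ (w : List Γ) (x : Fin k → Position w),
    χ.Realize w.get x ↔ φ.Realize (M := Position w) Empty.elim fun i => x (Fin.castLE hk i)

theorem exists_eq_var (t : (wordLanguage Γ).Term (Empty ⊕ Fin m)) : ∃ i, t = .var (Sum.inr i) := by
  rcases t with (i | i) | f
  · exact i.elim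
  · exact ⟨i, rfl⟩
  · exact Empty.elim f

theorem exists_expresses_equal (hk : m ≤ k) (t t' : (wordLanguage Γ).Term (Empty ⊕ Fin m)) :
    ∃ χ : WordQuery Γ k, χ.Expresses hk (.equal t t') := by
  obtain ⟨i, rfl⟩ := exists_eq_var t
  obtain ⟨j, rfl⟩ := exists_eq_var t'
  exact ⟨arith ((Term.var (Fin.castLE hk i)).equal (.var (Fin.castLE hk j))),
    fun w x => Formula.realize_equal⟩

theorem exists_expresses_rel (hk : m ≤ k) {l : ℕ} (R : (wordLanguage Γ).Relations l)
    (ts : Fin l → (wordLanguage Γ).Term (Empty ⊕ Fin m)) :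
    ∃ χ : WordQuery Γ k, χ.Expresses hk (.rel R ts) := by
  choose f hf using fun i => exists_eq_var (ts i)
  obtain rfl : ts = fun i => .var (Sum.inr (f i)) := funext hf
  cases R with
  | arith R =>
    exact ⟨arith (Relations.formula (L := arithLanguage) (show arithLanguage.Relations l from R)
      fun i => .var (Fin.castLE hk (f i))), fun w x => Formula.realize_rel⟩
  | letter a => exact ⟨letter a (Fin.castLE hk (f 0)), fun w x => List.getElem?_eq_some_iff.symm⟩

theorem Expresses.imp {hk : m ≤ k} {χ χ' : WordQuery Γ k}
    {φ φ' : (wordLanguage Γ).BoundedFormula Empty m} (h : χ.Expresses hk φ)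
    (h' : χ'.Expresses hk φ') : (not (and χ (not χ'))).Expresses hk (φ.imp φ') := fun w x => by
  rw [BoundedFormula.realize_imp, ← h, ← h']
  simp only [Realize, not_and, not_not]

theorem update_castLE_eq_snoc {α : Type*} (hk : m + 1 ≤ k) (x : Fin k → α) (b : α) :
    (fun i => Function.update x ⟨m, hk⟩ b (Fin.castLE hk i)) =
      (Fin.snoc (fun i => x (Fin.castLE (Nat.le_of_succ_le hk) i)) b : Fin (m + 1) → α) := by
  ext i
  cases i using Fin.lastCases with
  | last => rw [Fin.snoc_last]; exact Function.update_self ..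
  | cast i =>
    rw [Fin.snoc_castSucc, Function.update_of_ne (Fin.ne_of_val_ne i.2.ne)]
    rfl

theorem Expresses.all {hk : m + 1 ≤ k} {χ : WordQuery Γ k}
    {φ : (wordLanguage Γ).BoundedFormula Empty (m + 1)} (h : χ.Expresses hk φ) :
    (all ⟨m, hk⟩ χ).Expresses (Nat.le_of_succ_le hk) φ.all := fun w x => by
  rw [BoundedFormula.realize_all]
  exact forall_congr' fun b => (h w _).trans (by rw [update_castLE_eq_snoc])

open Filter in
theorem eventually_exists_expresses (φ : (wordLanguage Γ).BoundedFormula Empty m) :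
    ∀ᶠ k in atTop, ∀ hk : m ≤ k, ∃ χ : WordQuery Γ k, χ.Expresses hk φ := by
  induction φ with
  | falsum => exact .of_forall fun k hk => ⟨arith ⊥, fun _ _ => Iff.rfl⟩
  | equal t t' => exact .of_forall fun k hk => exists_expresses_equal hk t t'
  | rel R ts => exact .of_forall fun k hk => exists_expresses_rel hk R ts
  | imp φ φ' ih ih' =>
    filter_upwards [ih, ih'] with k h h' hk
    obtain ⟨χ, hχ⟩ := h hk
    obtain ⟨χ', hχ'⟩ := h' hk
    exact ⟨_, hχ.imp hχ'⟩
  | @all m φ ih =>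
    filter_upwards [ih, eventually_ge_atTop (m + 1)] with k h hk _
    obtain ⟨χ, hχ⟩ := h hk
    exact ⟨_, hχ.all⟩

end WordQuery

open FirstOrder.Language in
theorem inAC0_of_wordDefinable {Γ : Type} [Finite Γ] {L : Language Γ}
    (hL : WordDefinable fun w (_ : Empty → Position w) => w ∈ L) : InAC0 L := by
  obtain ⟨φ, hφ⟩ := hL
  obtain ⟨k, hk⟩ := (WordQuery.eventually_exists_expresses φ).exists
  obtain ⟨χ, hχ⟩ := hk k.zero_le
  refine χ.inAC0 fun w => (hφ w Empty.elim).symm.trans ((hχ w 0).trans ?_).symm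
  exact iff_of_eq (congrArg (BoundedFormula.Realize φ Empty.elim) (Subsingleton.elim _ _))

/-! ## Minimal positive supports are minimal matches -/

section Matches

variable {σ : Schema} {q : UCQNeg σ} {p : CQNeg σ} {D : Database σ} {ν ν' : Var → Const}

/-- The variables of a query. By safe negation, all of them occur in positive atoms. -/
def CQNeg.HasVar (p : CQNeg σ) (x : Var) : Prop := ∃ a ∈ p.pos, a.HasVar x

/-- `ν` is a match of `p` in `D`: it satisfies `p`, and the facts whose absence is required are over
the active domain, as a constant of a negated atom need not occur in `D`. -/
def CQNeg.IsMatch (p : CQNeg σ) (D : Database σ) (ν : Var → Const) : Prop :=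
  p.SatBy D ν ∧ ∀ a ∈ p.neg, ∀ i, (a.args i).eval ν ∈ activeDomain D

open Classical in
/-- The facts that instantiate the positive atoms of a query. -/
noncomputable def CQNeg.posFacts (p : CQNeg σ) (ν : Var → Const) : Database σ :=
  (p.pos.map (Atom.eval ν)).toFinset

/-- `S` consists of the positive facts of some match of `q` in `D`. -/
def UCQNeg.IsMatchImage (q : UCQNeg σ) (D S : Database σ) : Prop :=
  ∃ p ∈ q, ∃ ν, p.IsMatch D ν ∧ p.posFacts ν = S

theorem CQNeg.mem_posFacts {f : DBFact σ} : f ∈ p.posFacts ν ↔ ∃ a ∈ p.pos, a.eval ν = f := by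
  simp [CQNeg.posFacts]

theorem CQNeg.posFacts_subset_iff {S : Database σ} :
    p.posFacts ν ⊆ S ↔ ∀ a ∈ p.pos, a.eval ν ∈ S := by
  simp [Finset.subset_iff, CQNeg.mem_posFacts]

theorem CQNeg.IsMatch.posFacts_subset (h : p.IsMatch D ν) : p.posFacts ν ⊆ D :=
  CQNeg.posFacts_subset_iff.2 h.1.1

theorem DBFact.plus_injective : Function.Injective (DBFact.plus (σ := σ)) := by
  rintro ⟨R, c⟩ ⟨S, d⟩ h
  obtain rfl : R = S := Sum.inl_injective (congrArg DBFact.rel h)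
  exact congrArg (DBFact.mk R) (eq_of_heq ((DBFact.mk.injEq _ _ _ _).mp h).2)

theorem DBFact.minus_injective : Function.Injective (DBFact.minus (σ := σ)) := by
  rintro ⟨R, c⟩ ⟨S, d⟩ h
  obtain rfl : R = S := Sum.inr_injective (congrArg DBFact.rel h)
  exact congrArg (DBFact.mk R) (eq_of_heq ((DBFact.mk.injEq _ _ _ _).mp h).2)

theorem DBFact.plus_ne_minus (f g : DBFact σ) : f.plus ≠ g.minus := fun h =>
  Sum.inl_ne_inr (congrArg DBFact.rel h)

theorem plus_mem_plus_union_minus {A B : Set (DBFact σ)} {f : DBFact σ} :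
    f.plus ∈ DBFact.plus '' A ∪ DBFact.minus '' B ↔ f ∈ A := by
  simp [DBFact.plus_injective.eq_iff, (DBFact.plus_ne_minus _ _).symm]

theorem minus_mem_plus_union_minus {A B : Set (DBFact σ)} {f : DBFact σ} :
    f.minus ∈ DBFact.plus '' A ∪ DBFact.minus '' B ↔ f ∈ B := by
  simp [DBFact.minus_injective.eq_iff, DBFact.plus_ne_minus]

theorem CQNeg.satBy_signed {A B : Set (DBFact σ)} :
    p.signed.SatBy (DBFact.plus '' A ∪ DBFact.minus '' B) ν ↔
      (∀ a ∈ p.pos, a.eval ν ∈ A) ∧ (∀ a ∈ p.neg, a.eval ν ∈ B) ∧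
        ∀ e ∈ p.ineq, e.1.eval ν ≠ e.2.eval ν := by
  have pos (a : Atom σ) : a.plus.eval ν ∈ DBFact.plus '' A ∪ DBFact.minus '' B ↔ a.eval ν ∈ A :=
    plus_mem_plus_union_minus (f := a.eval ν)
  have neg (a : Atom σ) : a.minus.eval ν ∈ DBFact.plus '' A ∪ DBFact.minus '' B ↔ a.eval ν ∈ B :=
    minus_mem_plus_union_minus (f := a.eval ν)
  simp only [CQNeg.SatBy, CQNeg.signed, List.forall_mem_append, List.forall_mem_map,
    List.not_mem_nil, false_imp_iff, implies_true, true_and, and_assoc, pos, neg]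

theorem isPositiveSupport_iff {S : Database σ} :
    IsPositiveSupport q D S ↔ S ⊆ D ∧ ∃ T ⊆ S, q.IsMatchImage D T := by
  have absent (f : DBFact σ) : f ∈ negPart (signedDatabase D) ↔
      (∀ i, f.args i ∈ activeDomain D) ∧ f ∉ D := minus_mem_plus_union_minus
  refine and_congr_right fun hS => ?_
  simp only [UCQNeg.Holds, UCQNeg.signed, List.mem_map, exists_exists_and_eq_and,
    CQNeg.satBy_signed, absent]
  constructor
  · rintro ⟨p, hp, ν, hpos, hneg, hineq⟩
    exact ⟨p.posFacts ν, CQNeg.posFacts_subset_iff.2 hpos, p, hp, ν,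
      ⟨⟨fun a ha => hS (hpos a ha), fun a ha => (hneg a ha).2, hineq⟩,
        fun a ha => (hneg a ha).1⟩, rfl⟩
  · rintro ⟨_, hT, p, hp, ν, ⟨⟨_, hneg, hineq⟩, hdom⟩, rfl⟩
    exact ⟨p, hp, ν, CQNeg.posFacts_subset_iff.1 hT, fun a ha => ⟨hdom a ha, hneg a ha⟩, hineq⟩

theorem minimal_isPositiveSupport_iff {S : Database σ} :
    Minimal (IsPositiveSupport q D) S ↔ Minimal (q.IsMatchImage D) S := by
  refine minimal_iff_minimal_of_imp_of_forall (fun T hT => ?_) fun T hT =>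
    (isPositiveSupport_iff.1 hT).2
  obtain ⟨p, -, ν, h, rfl⟩ := id hT
  exact isPositiveSupport_iff.2 ⟨h.posFacts_subset, _, subset_rfl, hT⟩

theorem QTerm.eval_congr {t : QTerm} (h : ∀ x, t = .var x → ν x = ν' x) :
    t.eval ν = t.eval ν' := by
  cases t with
  | const c => rfl
  | var x => exact h x rfl

theorem Atom.eval_congr {a : Atom σ} (h : ∀ x, a.HasVar x → ν x = ν' x) :
    a.eval ν = a.eval ν' :=
  congrArg (DBFact.mk a.rel) (funext fun i => QTerm.eval_congr fun x hx => h x ⟨i, hx⟩)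

theorem CQNeg.posFacts_congr (h : ∀ x, p.HasVar x → ν x = ν' x) :
    p.posFacts ν = p.posFacts ν' := by
  rw [CQNeg.posFacts, List.map_congr_left fun a ha => Atom.eval_congr fun x hx => h x ⟨a, ha, hx⟩,
    CQNeg.posFacts]

theorem CQNeg.IsMatch.congr (hν : p.IsMatch D ν) (h : ∀ x, p.HasVar x → ν x = ν' x) :
    p.IsMatch D ν' := by
  obtain ⟨⟨hpos, hneg, hineq⟩, hdom⟩ := hν
  have neg {a} (ha : a ∈ p.neg) (x) (hx : a.HasVar x) : ν x = ν' x := h x (p.safe_neg a ha x hx)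
  refine ⟨⟨fun a ha => ?_, fun a ha => ?_, fun e he => ?_⟩, fun a ha i => ?_⟩
  · exact Atom.eval_congr (fun x hx => h x ⟨a, ha, hx⟩) ▸ hpos a ha
  · exact Atom.eval_congr (neg ha) ▸ hneg a ha
  · rw [← QTerm.eval_congr fun x hx => h x (p.safe_ineq e he x (Or.inl hx)),
      ← QTerm.eval_congr fun x hx => h x (p.safe_ineq e he x (Or.inr hx))]
    exact hineq e he
  · exact QTerm.eval_congr (fun x hx => neg ha x ⟨i, hx⟩) ▸ hdom a ha i

theorem CQNeg.IsMatch.mem_activeDomain (hν : p.IsMatch D ν) {x : Var} (hx : p.HasVar x) :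
    ν x ∈ activeDomain D := by
  obtain ⟨a, ha, i, hi⟩ := hx
  exact ⟨a.eval ν, hν.1.1 a ha, i, by simp only [Atom.eval, hi, QTerm.eval]⟩

theorem CQNeg.finite_setOf_hasVar (p : CQNeg σ) : {x | p.HasVar x}.Finite := by
  have h : {x | p.HasVar x} = ⋃ a ∈ {a | a ∈ p.pos}, ⋃ i, {x | a.args i = .var x} := by
    ext x
    simp [CQNeg.HasVar, Atom.HasVar]
  rw [h]
  exact (List.finite_toSet p.pos).biUnion fun a _ => Set.finite_iUnion fun i =>
    Set.Subsingleton.finite fun x hx y hy => QTerm.var.inj (hx.symm.trans hy)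

theorem exists_forall_hasVar_le (q : UCQNeg σ) : ∃ N, ∀ p ∈ q, ∀ x, p.HasVar x → x ≤ N := by
  obtain ⟨N, hN⟩ := ((List.finite_toSet q).biUnion fun p _ => p.finite_setOf_hasVar).bddAbove
  exact ⟨N, fun p hp x hx => hN (Set.mem_biUnion hp hx)⟩

/-- The valuation given by a tuple of names of constants. The tuple is nonempty and is read
cyclically, so that every variable has a value. -/
def tupleValuation {M : Type*} (name : M → Const) {N : ℕ} (s : Fin (N + 1) → M) : Var → Const :=
  fun x => name (s (Fin.ofNat (N + 1) x))

theorem isMatchImage_iff_exists_tuple {M : Type*} [Nonempty M] {name : M → Const}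
    (hname : activeDomain D ⊆ Set.range name) {N : ℕ} (hN : ∀ p ∈ q, ∀ x, p.HasVar x → x ≤ N)
    {S : Database σ} :
    q.IsMatchImage D S ↔ ∃ p ∈ q, ∃ s : Fin (N + 1) → M,
      p.IsMatch D (tupleValuation name s) ∧ p.posFacts (tupleValuation name s) = S := by
  refine exists_congr fun p => and_congr_right fun hp => ⟨?_, fun ⟨s, hs⟩ => ⟨_, hs⟩⟩
  rintro ⟨ν, hν, rfl⟩
  have agree (x : Var) (hx : p.HasVar x) :
      ν x = tupleValuation name (fun i : Fin (N + 1) => Function.invFun name (ν i)) x := by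
    simp only [tupleValuation, Fin.val_ofNat, Nat.mod_eq_of_lt (Nat.lt_succ_of_le (hN p hp x hx))]
    exact (Function.invFun_eq (hname (hν.mem_activeDomain hx))).symm
  exact ⟨_, hν.congr agree, (CQNeg.posFacts_congr agree).symm⟩

theorem positiveRelevant_iff_exists_tuple {M : Type*} [Nonempty M] {name : M → Const}
    (hname : activeDomain D ⊆ Set.range name) {N : ℕ} (hN : ∀ p ∈ q, ∀ x, p.HasVar x → x ≤ N)
    {α : DBFact σ} :
    PositiveRelevant q D α ↔ ∃ p ∈ q, ∃ s : Fin (N + 1) → M,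
      (p.IsMatch D (tupleValuation name s) ∧ α ∈ p.posFacts (tupleValuation name s)) ∧
      ∀ p' ∈ q, ∀ s' : Fin (N + 1) → M, p'.IsMatch D (tupleValuation name s') →
        p'.posFacts (tupleValuation name s') ⊆ p.posFacts (tupleValuation name s) →
        p.posFacts (tupleValuation name s) ⊆ p'.posFacts (tupleValuation name s') := by
  simp only [PositiveRelevant, minimal_isPositiveSupport_iff]
  simp only [Minimal, isMatchImage_iff_exists_tuple hname hN]
  constructor
  · rintro ⟨_, ⟨⟨p, hp, s, hs, rfl⟩, hmin⟩, hα⟩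
    exact ⟨p, hp, s, ⟨hs, hα⟩, fun p' hp' s' hs' => hmin ⟨p', hp', s', hs', rfl⟩⟩
  · rintro ⟨p, hp, s, ⟨hs, hα⟩, hmin⟩
    refine ⟨_, ⟨⟨p, hp, s, hs, rfl⟩, ?_⟩, hα⟩
    rintro _ ⟨p', hp', s', hs', rfl⟩
    exact hmin p' hp' s' hs'

end Matches

/-! ## Definability of positive relevance -/

section Facts

open UniformlyDefinable

variable {σ : Schema} {L : FirstOrder.Language} {X : Type*} {M : X → Type*}
  [∀ x, L.Structure (M x)] {ι : Type*} {R S : σ.Rel}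

theorem uniformlyDefinable_mk_eq_mk {c : ∀ x, (ι → M x) → Fin (σ.arity R) → Const}
    {d : ∀ x, (ι → M x) → Fin (σ.arity S) → Const}
    (h : ∀ i j, UniformlyDefinable L M fun x v => c x v i = d x v j) :
    UniformlyDefinable L M fun x v => (⟨R, c x v⟩ : DBFact σ) = ⟨S, d x v⟩ := by
  by_cases hRS : R = S
  · subst hRS
    exact (forall_finite fun i => h i i).congr fun x v => by
      rw [DBFact.mk.injEq, heq_eq_eq, funext_iff, and_iff_right rfl]
  · exact (const False).congr fun x v =>
      iff_of_false (fun e => hRS (congrArg DBFact.rel e)) not_false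

theorem uniformlyDefinable_mem_posFacts {p : CQNeg σ} {ν : ∀ x, (ι → M x) → Var → Const}
    {c : ∀ x, (ι → M x) → Fin (σ.arity R) → Const}
    (h : ∀ a ∈ p.pos, ∀ i j,
      UniformlyDefinable L M fun x v => (a.args i).eval (ν x v) = c x v j) :
    UniformlyDefinable L M fun x v => ⟨R, c x v⟩ ∈ p.posFacts (ν x v) :=
  (exists_mem p.pos fun a ha => uniformlyDefinable_mk_eq_mk (h a ha)).congr
    fun _ _ => CQNeg.mem_posFacts

end Facts

/-- An interpretation of databases in structures: the elements of `M x` name constants, among them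
all those that occur in `D x`, and the membership of facts in `D x`, the equality of names and the
names of the constants in `K` are definable by formulas that do not depend on `x`. -/
structure UniformInterpretation {σ : Schema} (L : FirstOrder.Language) {X : Type*} (M : X → Type*)
    [∀ x, L.Structure (M x)] (D : X → Database σ) (name : ∀ x, M x → Const) (K : Set Const) :
    Prop where
  activeDomain_subset (x : X) : activeDomain (D x) ⊆ Set.range (name x)
  definable_eq : UniformlyDefinable L M fun x (v : Fin 2 → M x) => name x (v 0) = name x (v 1)
  definable_eq_const : ∀ c ∈ K,
    UniformlyDefinable L M fun x (v : Unit → M x) => name x (v ()) = c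
  definable_mem (R : σ.Rel) : UniformlyDefinable L M fun x (v : Fin (σ.arity R) → M x) =>
    (⟨R, fun i => name x (v i)⟩ : DBFact σ) ∈ D x

namespace UniformInterpretation

open UniformlyDefinable

variable {σ : Schema} {L : FirstOrder.Language} {X : Type*} {M : X → Type*}
  [∀ x, L.Structure (M x)] {D : X → Database σ} {name : ∀ x, M x → Const} {K : Set Const}
  {ι : Type*}

theorem definable_eval_eq_eval (h : UniformInterpretation L M D name K) (f g : Var → ι)
    {t u : QTerm} (ht : ∀ c, t = .const c → c ∈ K) (hu : ∀ c, u = .const c → c ∈ K) :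
    UniformlyDefinable L M fun x v =>
      t.eval (fun y => name x (v (f y))) = u.eval fun y => name x (v (g y)) := by
  cases t with
  | const c =>
    cases u with
    | const d => exact const (c = d)
    | var y =>
      exact ((h.definable_eq_const c (ht c rfl)).reindex fun _ => g y).congr fun _ _ => eq_comm
  | var y =>
    cases u with
    | const d => exact (h.definable_eq_const d (hu d rfl)).reindex fun _ => f y
    | var z => exact h.definable_eq.reindex ![f y, g z]

theorem definable_name_eq_eval (h : UniformInterpretation L M D name K) (j : ι) (g : Var → ι)
    {t : QTerm} (ht : ∀ c, t = .const c → c ∈ K) :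
    UniformlyDefinable L M fun x v => name x (v j) = t.eval fun y => name x (v (g y)) :=
  h.definable_eval_eq_eval (t := .var 0) (fun _ => j) g (fun _ => nofun) ht

theorem definable_atom_mem (h : UniformInterpretation L M D name K) (f : Var → ι) {a : Atom σ}
    (ha : ∀ i c, a.args i = .const c → c ∈ K) :
    UniformlyDefinable L M fun x v => a.eval (fun y => name x (v (f y))) ∈ D x := by
  refine (iExs (κ := Fin (σ.arity a.rel)) (P := fun x v u =>
    (⟨a.rel, fun i => name x (u i)⟩ : DBFact σ) ∈ D x ∧
      ∀ i, name x (u i) = (a.args i).eval fun y => name x (v (f y)))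
    (((h.definable_mem a.rel).reindex Sum.inr).and (forall_finite fun i =>
      h.definable_name_eq_eval (Sum.inr i) (fun y => Sum.inl (f y)) (ha i)))).congr
    fun x v => ⟨fun hmem => ?_, ?_⟩
  · choose u hu using fun i => h.activeDomain_subset x ⟨_, hmem, i, rfl⟩
    exact ⟨u, Eq.mpr (congrArg (fun c => ⟨a.rel, c⟩ ∈ D x) (funext hu)) hmem, hu⟩
  · rintro ⟨u, hmem, hu⟩
    rwa [show (fun i => name x (u i)) = _ from funext hu] at hmem

theorem definable_eval_mem_activeDomain (h : UniformInterpretation L M D name K) (f : Var → ι)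
    {t : QTerm} (ht : ∀ c, t = .const c → c ∈ K) :
    UniformlyDefinable L M fun x v =>
      t.eval (fun y => name x (v (f y))) ∈ activeDomain (D x) := by
  have := σ.finite_rel
  refine (exists_finite fun R : σ.Rel => exists_finite fun i : Fin (σ.arity R) =>
    iExs (κ := Fin (σ.arity R)) (P := fun x v u =>
      (⟨R, fun i => name x (u i)⟩ : DBFact σ) ∈ D x ∧
        name x (u i) = t.eval fun y => name x (v (f y)))
    (((h.definable_mem R).reindex Sum.inr).and
      (h.definable_name_eq_eval (Sum.inr i) (fun y => Sum.inl (f y)) ht))).congr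
    fun x v => ⟨?_, ?_⟩
  · rintro ⟨⟨R, c⟩, hmem, i, hi⟩
    choose u hu using fun i => h.activeDomain_subset x ⟨_, hmem, i, rfl⟩
    refine ⟨R, i, u, ?_, (hu i).trans hi⟩
    rwa [show (fun i => name x (u i)) = c from funext hu]
  · rintro ⟨R, i, u, hmem, hi⟩
    exact ⟨_, hmem, i, hi⟩

variable {q : UCQNeg σ} {p p' : CQNeg σ}

theorem definable_isMatch (h : UniformInterpretation L M D name q.consts) (hp : p ∈ q)
    (f : Var → ι) :
    UniformlyDefinable L M fun x v => p.IsMatch (D x) fun y => name x (v (f y)) := by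
  have neg {a} (ha : a ∈ p.neg) (i) (c) (hc : a.args i = .const c) : c ∈ q.consts :=
    ⟨p, hp, Or.inr (Or.inl ⟨a, ha, i, hc⟩)⟩
  have ineq {e c} (he : e ∈ p.ineq) (hc : e.1 = .const c ∨ e.2 = .const c) : c ∈ q.consts :=
    ⟨p, hp, Or.inr (Or.inr ⟨e, he, hc⟩)⟩
  exact ((forall_mem _ fun a ha => h.definable_atom_mem f fun i c hc =>
      ⟨p, hp, Or.inl ⟨a, ha, i, hc⟩⟩).and
    ((forall_mem _ fun a ha => (h.definable_atom_mem f (neg ha)).not).and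
    (forall_mem _ fun e he => (h.definable_eval_eq_eval f f (fun c hc => ineq he (Or.inl hc))
      fun c hc => ineq he (Or.inr hc)).not))).and
    (forall_mem _ fun a ha => forall_finite fun i =>
      h.definable_eval_mem_activeDomain f (neg ha i))

theorem definable_posFacts_subset (h : UniformInterpretation L M D name q.consts) (hp : p ∈ q)
    (hp' : p' ∈ q) (f g : Var → ι) :
    UniformlyDefinable L M fun x v =>
      p.posFacts (fun y => name x (v (f y))) ⊆ p'.posFacts fun y => name x (v (g y)) :=
  (forall_mem p.pos fun a ha => uniformlyDefinable_mem_posFacts fun a' ha' i j =>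
    h.definable_eval_eq_eval g f (fun _ hc => ⟨p', hp', Or.inl ⟨a', ha', i, hc⟩⟩)
      fun _ hc => ⟨p, hp, Or.inl ⟨a, ha, j, hc⟩⟩).congr
    fun _ _ => CQNeg.posFacts_subset_iff

theorem definable_positiveRelevant (h : UniformInterpretation L M D name q.consts) (R : σ.Rel) :
    UniformlyDefinable L M fun x (v : Fin (σ.arity R) → M x) =>
      PositiveRelevant q (D x) ⟨R, fun i => name x (v i)⟩ := by
  obtain ⟨N, hN⟩ := exists_forall_hasVar_le q
  refine UniformlyDefinable.congr ?_ fun x v =>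
    have : Nonempty (M x) := ⟨v ⟨0, σ.arity_pos R⟩⟩
    positiveRelevant_iff_exists_tuple (h.activeDomain_subset x) hN
  let s (y : Var) : Fin (σ.arity R) ⊕ Fin (N + 1) := Sum.inr (Fin.ofNat (N + 1) y)
  let s' (y : Var) : (Fin (σ.arity R) ⊕ Fin (N + 1)) ⊕ Fin (N + 1) :=
    Sum.inr (Fin.ofNat (N + 1) y)
  exact exists_mem q fun p hp => iExs <|
    ((h.definable_isMatch hp s).and (uniformlyDefinable_mem_posFacts fun a ha i j =>
      (h.definable_name_eq_eval (Sum.inl j) s fun _ hc => ⟨p, hp, Or.inl ⟨a, ha, i, hc⟩⟩).congr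
        fun _ _ => eq_comm)).and <|
    forall_mem q fun p' hp' => iAlls <| (h.definable_isMatch hp' s').imp <|
      (h.definable_posFacts_subset hp' hp s' fun y => Sum.inl (s y)).imp <|
      h.definable_posFacts_subset hp hp' (fun y => Sum.inl (s y)) s'

end UniformInterpretation

open FirstOrder Language in
theorem uniformInterpretation_evalDomain {σ : Schema} (K : Set Const) :
    UniformInterpretation (schemaLanguage σ K) (fun D : Database σ => EvalDomain D K) id
      (fun _ c => c.1) K where
  activeDomain_subset _ c hc := ⟨⟨c, Or.inl hc⟩, rfl⟩
  definable_eq := (UniformlyDefinable.eq 0 1).congr fun _ _ => Subtype.ext_iff.symm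
  definable_eq_const c hc :=
    ⟨(Term.var ()).equal (Constants.term (L := schemaLanguage σ K)
      (show (schemaLanguage σ K).Functions 0 from ⟨⟨c, hc⟩, rfl⟩)),
      fun _ _ => Formula.realize_equal.trans Subtype.ext_iff⟩
  definable_mem R :=
    ⟨Relations.formula (L := schemaLanguage σ K)
      (show (schemaLanguage σ K).Relations (σ.arity R) from ⟨R, rfl⟩) .var,
      fun _ _ => Formula.realize_rel⟩

theorem exists_formula_positiveRelevant {σ : Schema} (q : UCQNeg σ) (R : σ.Rel) :
    ∃ φ : (schemaLanguage σ q.consts).Formula (Fin (σ.arity R)),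
      ∀ (D : Database σ) (c : Fin (σ.arity R) → Const) (hc : ⟨R, c⟩ ∈ D),
        φ.Realize (factArgs q.consts hc) ↔ PositiveRelevant q D ⟨R, c⟩ := by
  obtain ⟨φ, hφ⟩ := (uniformInterpretation_evalDomain q.consts).definable_positiveRelevant R
  exact ⟨φ, fun D c hc => hφ D _⟩

/-! ## Words that represent databases -/

section Spells

variable {Γ : Type} {w u u' : List Γ} {a b : Position w}

/-- The letters of `w` from position `a` up to position `b` form the word `u`. -/
def Spells (w : List Γ) (a b : Position w) (u : List Γ) : Prop := w.drop a = u ++ w.drop b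

theorem Spells.val_eq_add_length (h : Spells w a b u) : (b : ℕ) = a + u.length := by
  have := congrArg List.length h
  simp only [List.length_append, List.length_drop] at this
  omega

theorem spells_nil_iff : Spells w a b [] ↔ a = b :=
  ⟨fun h => Fin.ext h.val_eq_add_length.symm, fun h => congrArg w.drop (congrArg Fin.val h)⟩

theorem drop_eq_append_iff : w.drop a = u ++ u' ↔ ∃ c, Spells w a c u ∧ w.drop c = u' := by
  constructor
  · intro h
    have hlen := congrArg List.length h
    simp only [List.length_append, List.length_drop] at hlen
    have hdrop : w.drop (a + u.length) = u' := by rw [← List.drop_drop, h, List.drop_left]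
    exact ⟨⟨a + u.length, by omega⟩, h.trans (congrArg (u ++ ·) hdrop.symm), hdrop⟩
  · rintro ⟨c, hu, rfl⟩
    exact hu

theorem spells_append_iff : Spells w a b (u ++ u') ↔ ∃ c, Spells w a c u ∧ Spells w c b u' := by
  rw [Spells, List.append_assoc, drop_eq_append_iff]
  rfl

theorem spells_singleton_iff {x : Γ} : Spells w a b [x] ↔ w[(a : ℕ)]? = some x ∧ a ⋖ b := by
  rw [Spells, List.singleton_append, Fin.covBy_iff, Nat.covBy_iff_add_one_eq]
  constructor
  · intro h
    have hlen := congrArg List.length h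
    simp only [List.length_cons, List.length_drop] at hlen
    exact ⟨by rw [← List.head?_drop, h, List.head?_cons], by omega⟩
  · rintro ⟨hx, hb⟩
    obtain ⟨ha, rfl⟩ := List.getElem?_eq_some_iff.1 hx
    rw [← hb, List.drop_eq_getElem_cons ha]

theorem spells_cons_iff {x : Γ} :
    Spells w a b (x :: u) ↔ w[(a : ℕ)]? = some x ∧ ∃ c, a ⋖ c ∧ Spells w c b u := by
  rw [← List.singleton_append, spells_append_iff]
  simp only [spells_singleton_iff, and_assoc, exists_and_left]

theorem spells_flatten_ofFn_iff {k : ℕ} {u : Fin k → List Γ} :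
    Spells w a b (List.ofFn u).flatten ↔ ∃ e : Fin (k + 1) → Position w,
      e 0 = a ∧ e (Fin.last k) = b ∧ ∀ m : Fin k, Spells w (e m.castSucc) (e m.succ) (u m) := by
  induction k generalizing a with
  | zero =>
    rw [List.ofFn_zero, List.flatten_nil, spells_nil_iff]
    exact ⟨fun h => ⟨fun _ => a, rfl, h, nofun⟩, fun ⟨e, ha, hb, _⟩ => ha.symm.trans hb⟩
  | succ k ih =>
    simp only [List.ofFn_succ, List.flatten_cons, spells_append_iff, ih]
    constructor
    · rintro ⟨_, h, e, rfl, hb, he⟩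
      exact ⟨Fin.cons a e, rfl, hb, Fin.cases h he⟩
    · rintro ⟨e, rfl, hb, he⟩
      exact ⟨e 1, he 0, fun m => e m.succ, rfl, hb, fun m => he m.succ⟩

theorem exists_spells_map_iff {β : Type*} {f : β → Γ} :
    (∃ c : List β, Spells w a b (c.map f)) ↔
      a ≤ b ∧ ∀ j, a ≤ j → j < b → ∃ x, w[(j : ℕ)]? = some (f x) := by
  constructor
  · rintro ⟨c, hc⟩
    induction c generalizing a with
    | nil =>
      obtain rfl := spells_nil_iff.1 hc
      exact ⟨le_rfl, fun j hj hj' => absurd hj hj'.not_ge⟩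
    | cons x c ih =>
      obtain ⟨hx, d, had, hc⟩ := spells_cons_iff.1 hc
      obtain ⟨hdb, h⟩ := ih hc
      refine ⟨had.le.trans hdb, fun j haj hjb => ?_⟩
      rcases haj.eq_or_lt with rfl | haj
      · exact ⟨x, hx⟩
      · exact h j (had.ge_of_gt haj) hjb
  · rintro ⟨hab, h⟩
    induction a using WellFoundedGT.induction with
    | ind a ih =>
      rcases hab.eq_or_lt with rfl | hlt
      · exact ⟨[], spells_nil_iff.2 rfl⟩
      · obtain ⟨x, hx⟩ := h a le_rfl hlt
        obtain ⟨d, had, hdb⟩ := exists_covBy_le_of_lt hlt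
        obtain ⟨c, hc⟩ := ih d had.lt hdb fun j hj => h j (had.le.trans hj)
        exact ⟨x :: c, spells_cons_iff.2 ⟨hx, d, had, hc⟩⟩

end Spells

section Encoding

variable {σ : Schema} {w : List (DBSymbol σ)} {a b : Position w} {c : Const} {f g : DBFact σ}

/-- The constant whose bits are the longest initial sequence of bits of a word. -/
def decodeBits : List (DBSymbol σ) → Const
  | Sum.inl (some x) :: l => x :: decodeBits l
  | _ => []

/-- The constant that starts at a position of a word. -/
def constAt (w : List (DBSymbol σ)) (i : Position w) : Const := decodeBits (w.drop i)

theorem decodeBits_encodeConst_append (c : Const) (l : List (DBSymbol σ)) :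
    decodeBits (encodeConst σ c ++ l) = c := by
  induction c with
  | nil => rfl
  | cons x c ih => exact congrArg (x :: ·) ih

theorem decodeBits_eq_cons_iff {l : List (DBSymbol σ)} {x : Bool} :
    decodeBits l = x :: c ↔ l[0]? = some (Sum.inl (some x)) ∧ decodeBits l.tail = c := by
  rcases l with _ | ⟨(_ | y) | R, l⟩ <;> simp [decodeBits]

theorem decodeBits_eq_nil_iff {l : List (DBSymbol σ)} :
    decodeBits l = [] ↔ ∀ x, l[0]? ≠ some (Sum.inl (some x)) := by
  rcases l with _ | ⟨(_ | y) | R, l⟩ <;> simp [decodeBits]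

theorem length_decodeBits_le (l : List (DBSymbol σ)) : (decodeBits l).length ≤ l.length := by
  induction l with
  | nil => exact le_rfl
  | cons s l ih => rcases s with (_ | _) | _ <;> simp [decodeBits, ih]

theorem getElem?_decodeBits (l : List (DBSymbol σ)) (d : ℕ) (x : Bool) :
    (decodeBits l)[d]? = some x ↔ l[d]? = some (Sum.inl (some x)) ∧
      ∀ d' < d, ∃ y, l[d']? = some (Sum.inl (some y)) := by
  induction l generalizing d with
  | nil => simp [decodeBits]
  | cons s l ih =>
    cases d with
    | zero => rcases s with (_ | y) | R <;> simp [decodeBits]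
    | succ d =>
      rw [Nat.forall_lt_succ_left]
      rcases s with (_ | y) | R <;> simp [decodeBits, ih]

theorem getElem?_constAt {d : ℕ} {x : Bool} :
    (constAt w a)[d]? = some x ↔ ∃ e : Position w, (a : ℕ) + d = e ∧
      w[(e : ℕ)]? = some (Sum.inl (some x)) ∧
      ∀ j, a ≤ j → j < e → ∃ y, w[(j : ℕ)]? = some (Sum.inl (some y)) := by
  simp only [constAt, getElem?_decodeBits, List.getElem?_drop]
  constructor
  · rintro ⟨hx, h⟩
    have hlt := (List.getElem?_eq_some_iff.1 hx).1
    refine ⟨⟨a + d, Nat.lt_succ_of_lt hlt⟩, rfl, hx, fun j haj hjd => ?_⟩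
    obtain ⟨d', hd'⟩ := Nat.exists_eq_add_of_le (Fin.le_def.1 haj)
    rw [hd']
    exact h d' (by rw [Fin.lt_def] at hjd; simp only at hjd; omega)
  · rintro ⟨e, he, hx, h⟩
    exact ⟨by rwa [he], fun d' hd' => h ⟨a + d', by omega⟩ (by simp [Fin.le_def])
      (Fin.lt_def.2 (by simp only; omega))⟩

theorem constAt_eq_constAt_iff :
    constAt w a = constAt w b ↔
      ∀ (d : Position w) (x : Bool),
        (constAt w a)[(d : ℕ)]? = some x ↔ (constAt w b)[(d : ℕ)]? = some x := by
  refine ⟨fun h d x => by rw [h], fun h => List.ext_getElem? fun d => ?_⟩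
  by_cases hd : d < w.length + 1
  · exact Option.ext fun x => h ⟨d, hd⟩ x
  · have none_of_le (i : Position w) : (constAt w i)[d]? = none :=
      List.getElem?_eq_none ((length_decodeBits_le _).trans (by rw [List.length_drop]; omega))
    rw [none_of_le, none_of_le]

theorem constAt_eq_nil_iff : constAt w a = [] ↔ ∀ x, w[(a : ℕ)]? ≠ some (Sum.inl (some x)) := by
  rw [constAt, decodeBits_eq_nil_iff, List.getElem?_drop, add_zero]

theorem constAt_eq_cons_iff {x : Bool} : constAt w a = x :: c ↔
    w[(a : ℕ)]? = some (Sum.inl (some x)) ∧ ∃ b, a ⋖ b ∧ constAt w b = c := by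
  rw [constAt, decodeBits_eq_cons_iff, List.getElem?_drop, add_zero, List.tail_drop]
  refine and_congr_right fun hx => ⟨fun h => ?_, ?_⟩
  · exact ⟨⟨a + 1, Nat.succ_lt_succ (List.getElem?_eq_some_iff.1 hx).1⟩,
      Fin.covBy_iff.2 (Nat.covBy_iff_add_one_eq.2 rfl), h⟩
  · rintro ⟨b, hab, rfl⟩
    rw [Nat.covBy_iff_add_one_eq.1 (Fin.covBy_iff.1 hab), constAt]

theorem Spells.constAt_eq (h : Spells w a b (encodeConst σ c)) : constAt w a = c := by
  rw [constAt, h, decodeBits_encodeConst_append]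

theorem spells_encodeConst_iff :
    Spells w a b (encodeConst σ c) ↔ (∃ e, (a ≤ e ∧ ∀ j, a ≤ j → j < e →
      ∃ x, w[(j : ℕ)]? = some (Sum.inl (some x))) ∧ w[(e : ℕ)]? = some (Sum.inl none) ∧ e ⋖ b) ∧
      constAt w a = c := by
  simp only [← exists_spells_map_iff, ← spells_singleton_iff]
  constructor
  · intro h
    obtain ⟨e, hc, he⟩ := spells_append_iff.1 h
    exact ⟨⟨e, ⟨c, hc⟩, he⟩, h.constAt_eq⟩
  · rintro ⟨⟨e, ⟨d, hd⟩, he⟩, rfl⟩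
    have h : Spells w a b (encodeConst σ d) := spells_append_iff.2 ⟨e, hd, he⟩
    rwa [h.constAt_eq]

theorem spells_encodeFact_iff : Spells w a b (encodeFact f) ↔
    w[(a : ℕ)]? = some (Sum.inr f.rel) ∧ ∃ e : Fin (σ.arity f.rel + 1) → Position w, a ⋖ e 0 ∧
      e (Fin.last _) = b ∧ ∀ m : Fin (σ.arity f.rel),
        Spells w (e m.castSucc) (e m.succ) (encodeConst σ (f.args m)) := by
  rw [encodeFact, spells_cons_iff, List.flatMap_def, List.map_ofFn]
  simp only [spells_flatten_ofFn_iff]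
  exact and_congr_right fun _ => ⟨fun ⟨_, h, e, h0, he⟩ => ⟨e, h0 ▸ h, he⟩,
    fun ⟨e, h, he⟩ => ⟨_, h, e, rfl, he⟩⟩

theorem Spells.exists_args_eq {R : σ.Rel} {d : Fin (σ.arity R) → Const}
    (h : Spells w a b (encodeFact ⟨R, d⟩)) :
    ∃ v : Fin (σ.arity R) → Position w, d = fun m => constAt w (v m) := by
  obtain ⟨-, e, -, -, he⟩ := spells_encodeFact_iff.1 h
  exact ⟨fun m => e m.castSucc, funext fun m => (he m).constAt_eq.symm⟩

theorem flatMap_encodeConst_prefix_free {k : ℕ} {c d : Fin k → Const} {l l' : List (DBSymbol σ)}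
    (h : (List.ofFn c).flatMap (encodeConst σ) ++ l = (List.ofFn d).flatMap (encodeConst σ) ++ l') :
    c = d := by
  induction k with
  | zero => exact Subsingleton.elim _ _
  | succ k ih =>
    simp only [List.ofFn_succ, List.flatMap_cons, List.append_assoc] at h
    have h0 : c 0 = d 0 := by
      simpa only [decodeBits_encodeConst_append] using congrArg decodeBits h
    rw [h0] at h
    exact funext (Fin.cases h0 (congrFun (ih (List.append_cancel_left h))))

theorem encodeFact_prefix_free {l l' : List (DBSymbol σ)}
    (h : encodeFact f ++ l = encodeFact g ++ l') : f = g := by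
  obtain ⟨R, c⟩ := f
  obtain ⟨S, d⟩ := g
  obtain ⟨hrel, hargs⟩ := List.cons.inj h
  obtain rfl := Sum.inr_injective hrel
  exact congrArg (DBFact.mk R) (flatMap_encodeConst_prefix_free hargs)

end Encoding

section FactSequences

variable {σ : Schema} {w : List (DBSymbol σ)} {f : DBFact σ} {l : List (DBFact σ)}

theorem exists_eq_append_of_getElem?_flatMap_encodeFact {i : ℕ} {R : σ.Rel}
    (h : (l.flatMap encodeFact)[i]? = some (Sum.inr R)) :
    ∃ l₁ f l₂, l = l₁ ++ f :: l₂ ∧ i = (l₁.flatMap encodeFact).length ∧ f.rel = R := by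
  induction l generalizing i with
  | nil => simp at h
  | cons g l ih =>
    rw [List.flatMap_cons] at h
    by_cases hi : i < (encodeFact g).length
    · rw [List.getElem?_append_left hi] at h
      cases i with
      | zero => exact ⟨[], g, l, rfl, rfl, Sum.inr_injective (Option.some.inj h)⟩
      | succ i =>
        have := List.mem_of_getElem?
          (show ((List.ofFn g.args).flatMap (encodeConst σ))[i]? = _ from h)
        simp [encodeConst] at this
    · rw [List.getElem?_append_right (not_lt.1 hi)] at h
      obtain ⟨l₁, f, l₂, rfl, hlen, hf⟩ := ih h
      refine ⟨g :: l₁, f, l₂, rfl, ?_, hf⟩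
      rw [List.flatMap_cons, List.length_append, ← hlen]
      omega

theorem drop_flatMap_encodeFact (l₁ l₂ : List (DBFact σ)) :
    ((l₁ ++ l₂).flatMap encodeFact).drop (l₁.flatMap encodeFact).length =
      l₂.flatMap encodeFact := by
  rw [List.flatMap_append, List.drop_left]

/-- A position of a word where a fact may start or the word ends. -/
def IsBoundary (w : List (DBSymbol σ)) (i : Position w) : Prop :=
  i = Fin.last _ ∨ ∃ R, w[(i : ℕ)]? = some (Sum.inr R)

theorem isBoundary_of_drop_eq {i : Position w} (h : w.drop i = l.flatMap encodeFact) :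
    IsBoundary w i := by
  cases l with
  | nil => exact Or.inl (Fin.last_le_iff.1 (List.drop_eq_nil_iff.1 h))
  | cons f l => exact Or.inr ⟨f.rel, by rw [← List.head?_drop, h]; rfl⟩

theorem exists_drop_eq_flatMap_encodeFact {i : Position w} (hi : IsBoundary w i)
    (h : ∀ (i : Position w) R, w[(i : ℕ)]? = some (Sum.inr R) →
      ∃ j, (∃ c, Spells w i j (encodeFact ⟨R, c⟩)) ∧ IsBoundary w j) :
    ∃ l : List (DBFact σ), w.drop i = l.flatMap encodeFact := by
  induction i using WellFoundedGT.induction with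
  | ind i ih =>
    rcases hi with rfl | ⟨R, hR⟩
    · exact ⟨[], List.drop_length⟩
    · obtain ⟨j, ⟨c, hs⟩, hj⟩ := h i R hR
      obtain ⟨l, hl⟩ := ih j (by
        rw [Fin.lt_def, hs.val_eq_add_length, encodeFact, List.length_cons]; omega) hj
      exact ⟨⟨R, c⟩ :: l, by rw [hs, hl, List.flatMap_cons]⟩

theorem exists_eq_flatMap_encodeFact_iff :
    (∃ l : List (DBFact σ), w = l.flatMap encodeFact) ↔ IsBoundary w 0 ∧
      ∀ (i : Position w) R, w[(i : ℕ)]? = some (Sum.inr R) →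
        ∃ j, (∃ c, Spells w i j (encodeFact ⟨R, c⟩)) ∧ IsBoundary w j := by
  constructor
  · rintro ⟨l, rfl⟩
    refine ⟨isBoundary_of_drop_eq rfl, fun i R hR => ?_⟩
    obtain ⟨l₁, f, l₂, rfl, hi, rfl⟩ := exists_eq_append_of_getElem?_flatMap_encodeFact hR
    have hdrop := drop_flatMap_encodeFact l₁ (f :: l₂)
    rw [← hi] at hdrop
    obtain ⟨j, hs, hj⟩ := drop_eq_append_iff.1 hdrop
    exact ⟨j, ⟨f.args, hs⟩, isBoundary_of_drop_eq hj⟩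
  · rintro ⟨h0, h⟩
    exact exists_drop_eq_flatMap_encodeFact h0 h

theorem finite_setOf_spells_encodeFact (w : List (DBSymbol σ)) :
    {f | ∃ i j : Position w, i ≠ 0 ∧ Spells w i j (encodeFact f)}.Finite := by
  have := σ.finite_rel
  refine (Set.finite_range fun x : Σ R, Fin (σ.arity R) → Position w =>
    (⟨x.1, fun m => constAt w (x.2 m)⟩ : DBFact σ)).subset ?_
  rintro ⟨R, c⟩ ⟨i, j, -, h⟩
  obtain ⟨v, rfl⟩ := h.exists_args_eq
  exact ⟨⟨R, v⟩, rfl⟩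

/-- The facts that are written in a word elsewhere than at its beginning. If the word represents
`(D, α)`, this is the database `D`. -/
noncomputable def wordDatabase (w : List (DBSymbol σ)) : Database σ :=
  (finite_setOf_spells_encodeFact w).toFinset

theorem mem_wordDatabase :
    f ∈ wordDatabase w ↔ ∃ i j : Position w, i ≠ 0 ∧ Spells w i j (encodeFact f) :=
  Set.Finite.mem_toFinset _

theorem mem_wordDatabase_flatMap_cons {α : DBFact σ} :
    f ∈ wordDatabase ((α :: l).flatMap encodeFact) ↔ f ∈ l := by
  rw [mem_wordDatabase]
  constructor
  · rintro ⟨i, j, hi, hs⟩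
    obtain ⟨l₁, g, l₂, hl, hlen, -⟩ :=
      exists_eq_append_of_getElem?_flatMap_encodeFact (spells_encodeFact_iff.1 hs).1
    have hg : ((α :: l).flatMap encodeFact).drop i = (g :: l₂).flatMap encodeFact := by
      rw [hlen, hl, drop_flatMap_encodeFact]
    obtain rfl := encodeFact_prefix_free (hs.symm.trans hg)
    rcases List.cons_eq_append_iff.1 hl with ⟨rfl, -⟩ | ⟨l₁, rfl, rfl⟩
    · exact absurd (Fin.ext hlen) hi
    · simp
  · intro h
    obtain ⟨l₁, l₂, rfl⟩ := List.append_of_mem h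
    have hdrop := drop_flatMap_encodeFact (α :: l₁) (f :: l₂)
    have hle : ((α :: l₁).flatMap encodeFact).length ≤
        ((α :: (l₁ ++ f :: l₂)).flatMap encodeFact).length := by
      rw [← List.cons_append, List.flatMap_append, List.length_append]
      exact Nat.le_add_right _ _
    obtain ⟨j, hj, -⟩ := drop_eq_append_iff (a := ⟨_, Nat.lt_succ_of_le hle⟩).1 hdrop
    exact ⟨_, j, Fin.ne_of_val_ne (Nat.succ_ne_zero _), hj⟩

theorem mem_relevanceLanguage_iff {q : UCQNeg σ} : w ∈ relevanceLanguage q ↔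
    (∃ l : List (DBFact σ), w = l.flatMap encodeFact) ∧
      ∃ α j, Spells w 0 j (encodeFact α) ∧
        α ∈ wordDatabase w ∧ PositiveRelevant q (wordDatabase w) α := by
  constructor
  · rintro ⟨D, α, ⟨l, hl, rfl⟩, hα, h⟩
    obtain ⟨j, hj, -⟩ := drop_eq_append_iff (a := 0).1
      (List.drop_zero (l := encodeFact α ++ l.flatMap encodeFact))
    obtain rfl : wordDatabase ((α :: l).flatMap encodeFact) = D :=
      Finset.ext fun f => mem_wordDatabase_flatMap_cons.trans (hl f)
    exact ⟨⟨α :: l, rfl⟩, α, j, hj, hα, h⟩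
  · rintro ⟨⟨l, rfl⟩, α, j, hj, hα, h⟩
    cases l with
    | nil => exact absurd (congrArg List.length hj) (by simp [encodeFact])
    | cons g l =>
      obtain rfl : g = α := encodeFact_prefix_free hj
      exact ⟨_, g, ⟨l, fun f => mem_wordDatabase_flatMap_cons.symm, rfl⟩, hα, h⟩

end FactSequences

section WordDefinability

open UniformlyDefinable

variable {σ : Schema} {ι : Type}

theorem wordDefinable_apply_zero {Γ : Type}
    {P : ∀ w : List Γ, (ι → Position w) → Position w → Prop}
    (hP : WordDefinable fun w (v : ι ⊕ Unit → Position w) =>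
      P w (fun i => v (Sum.inl i)) (v (Sum.inr ()))) :
    WordDefinable fun w v => P w v 0 :=
  (ex (P := fun w v a => a = 0 ∧ P w v a)
    ((foDefinable_eq_zero _).wordDefinable.and hP)).congr fun _ _ => exists_eq_left.symm

theorem wordDefinable_bit (i : ι) :
    WordDefinable fun (w : List (DBSymbol σ)) v => ∃ x, w[(v i : ℕ)]? = some (Sum.inl (some x)) :=
  exists_finite fun _ => wordDefinable_getElem?_eq_some _ i

theorem wordDefinable_bits (i j : ι) :
    WordDefinable fun (w : List (DBSymbol σ)) v => ∀ d, v i ≤ d → d < v j →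
      ∃ x, w[(d : ℕ)]? = some (Sum.inl (some x)) :=
  all ((foDefinable_le _ _).wordDefinable.imp
    ((foDefinable_lt _ _).wordDefinable.imp (wordDefinable_bit _)))

theorem wordDefinable_getElem?_constAt_eq_some (i d : ι) (x : Bool) :
    WordDefinable fun (w : List (DBSymbol σ)) v =>
      (constAt w (v i))[(v d : ℕ)]? = some x :=
  (ex ((foDefinable_add _ _ _).wordDefinable.and
    ((wordDefinable_getElem?_eq_some _ _).and (wordDefinable_bits _ _)))).congr
    fun _ _ => getElem?_constAt

theorem wordDefinable_constAt_eq_constAt (i j : ι) :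
    WordDefinable fun (w : List (DBSymbol σ)) v => constAt w (v i) = constAt w (v j) :=
  (all (forall_finite fun _ => (wordDefinable_getElem?_constAt_eq_some _ _ _).iff
    (wordDefinable_getElem?_constAt_eq_some _ _ _))).congr fun _ _ => constAt_eq_constAt_iff

theorem wordDefinable_constAt_eq (c : Const) (i : ι) :
    WordDefinable fun (w : List (DBSymbol σ)) v => constAt w (v i) = c := by
  induction c generalizing ι with
  | nil =>
    exact (forall_finite fun x => (wordDefinable_getElem?_eq_some _ i).not).congr
      fun _ _ => constAt_eq_nil_iff
  | cons x c ih =>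
    exact ((wordDefinable_getElem?_eq_some _ _).and
      (ex ((foDefinable_covBy _ _).wordDefinable.and (ih _)))).congr
      fun _ _ => constAt_eq_cons_iff

theorem wordDefinable_spells_encodeFact (i j : ι) (R : σ.Rel) (f : Fin (σ.arity R) → ι) :
    WordDefinable fun w v =>
      Spells w (v i) (v j) (encodeFact ⟨R, fun m => constAt w (v (f m))⟩) := by
  simp only [spells_encodeFact_iff, spells_encodeConst_iff]
  exact (wordDefinable_getElem?_eq_some _ _).and (iExs
    ((foDefinable_covBy (Sum.inl i) (Sum.inr 0)).wordDefinable.and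
    ((UniformlyDefinable.eq (Sum.inr (Fin.last _)) (Sum.inl j)).and (forall_finite fun m =>
      (ex (((foDefinable_le _ _).wordDefinable.and (wordDefinable_bits _ _)).and
        ((wordDefinable_getElem?_eq_some _ _).and (foDefinable_covBy _ _).wordDefinable))).and
      (wordDefinable_constAt_eq_constAt _ _)))))

theorem wordDefinable_exists_spells_encodeFact (i j : ι) (R : σ.Rel) :
    WordDefinable fun w v => ∃ c, Spells w (v i) (v j) (encodeFact ⟨R, c⟩) :=
  (iExs (κ := Fin (σ.arity R)) (P := fun w v u =>
    Spells w (v i) (v j) (encodeFact ⟨R, fun m => constAt w (u m)⟩))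
    (wordDefinable_spells_encodeFact _ _ R Sum.inr)).congr fun w v => by
    constructor
    · rintro ⟨c, h⟩
      obtain ⟨u, rfl⟩ := h.exists_args_eq
      exact ⟨u, h⟩
    · rintro ⟨u, h⟩
      exact ⟨_, h⟩

theorem wordDefinable_isBoundary (i : ι) :
    WordDefinable fun (w : List (DBSymbol σ)) v => IsBoundary w (v i) := by
  have := σ.finite_rel
  exact (foDefinable_eq_last i).wordDefinable.or
    (exists_finite fun _ => wordDefinable_getElem?_eq_some _ i)

theorem wordDefinable_exists_eq_flatMap_encodeFact :
    WordDefinable fun w (_ : ι → Position w) =>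
      ∃ l : List (DBFact σ), w = l.flatMap encodeFact := by
  have := σ.finite_rel
  simp only [exists_eq_flatMap_encodeFact_iff]
  exact (wordDefinable_apply_zero (wordDefinable_isBoundary _)).and (all (forall_finite fun R =>
    (wordDefinable_getElem?_eq_some _ _).imp (ex
      ((wordDefinable_exists_spells_encodeFact _ _ R).and (wordDefinable_isBoundary _)))))

theorem uniformInterpretation_wordDatabase (σ : Schema) (K : Set Const) :
    UniformInterpretation (wordLanguage (DBSymbol σ)) (fun w : List (DBSymbol σ) => Position w)
      wordDatabase constAt K where
  activeDomain_subset w := by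
    rintro _ ⟨f, hf, m, rfl⟩
    obtain ⟨i, j, -, h⟩ := mem_wordDatabase.1 hf
    obtain ⟨v, hv⟩ := h.exists_args_eq
    exact ⟨v m, (congrFun hv m).symm⟩
  definable_eq := wordDefinable_constAt_eq_constAt 0 1
  definable_eq_const c _ := wordDefinable_constAt_eq c ()
  definable_mem R :=
    (ex (ex ((foDefinable_eq_zero _).wordDefinable.not.and
      (wordDefinable_spells_encodeFact _ _ R _)))).congr fun _ _ => mem_wordDatabase

theorem inAC0_relevanceLanguage (q : UCQNeg σ) : InAC0 (relevanceLanguage q) := by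
  have := σ.finite_rel
  have hI := uniformInterpretation_wordDatabase σ q.consts
  refine inAC0_of_wordDefinable ?_
  simp only [mem_relevanceLanguage_iff]
  have hfirst (R : σ.Rel) : WordDefinable fun w (u : Fin (σ.arity R) → Position w) =>
      ∃ j, Spells w 0 j (encodeFact ⟨R, fun m => constAt w (u m)⟩) :=
    wordDefinable_apply_zero (P := fun w u i =>
      ∃ j, Spells w i j (encodeFact ⟨R, fun m => constAt w (u m)⟩))
      (ex (wordDefinable_spells_encodeFact _ _ R _))
  refine wordDefinable_exists_eq_flatMap_encodeFact.and ((exists_finite fun R => exists_tuple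
    ((hfirst R).and ((hI.definable_mem R).and (hI.definable_positiveRelevant R)))).congr
    fun w _ => ⟨?_, ?_⟩)
  · rintro ⟨⟨R, c⟩, j, hj, h⟩
    obtain ⟨u, rfl⟩ := hj.exists_args_eq
    exact ⟨R, u, ⟨j, hj⟩, h⟩
  · rintro ⟨R, u, ⟨j, hj⟩, h⟩
    exact ⟨_, j, hj, h⟩

end WordDefinability

theorem mainTheorem7 (σ : Schema) (q : UCQNeg σ) :
    (∃ φ : ∀ R : σ.Rel, (schemaLanguage σ q.consts).Formula (Fin (σ.arity R)),
      ∀ (D : Database σ) (α : DBFact σ) (hα : α ∈ D),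
        (φ α.rel).Realize (factArgs q.consts hα) ↔ PositiveRelevant q D α) ∧
    InAC0 (relevanceLanguage q) := by
  choose φ hφ using exists_formula_positiveRelevant q
  exact ⟨⟨φ, fun D α hα => hφ α.rel D α.args hα⟩, inAC0_relevanceLanguage q⟩
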